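/- Consider a network of controllers in the plane $\mathbb{R}^2$, seen from a typical actuator at the origin. The typical controller (index $0$) is at distance $r_0>0$; the other controllers $i=1,2,\dots$, at distances $r_i$ from the origin, form a homogeneous Poisson point process $\Phi$ of intensity $\lambda>0$. Under classical ALOHA with parameter $q\in[0,1]$, in every slot $t$ each controller $i\ge 0$ transmits ($C_i(t)=1$) with probability $q$ and is silent ($C_i(t)=0$) otherwise. The fading coefficients $h_i(t)$ are Rayleigh with $|h_i(t)|^2$ exponentially distributed with mean $1$. All $h_i(t)$ and $C_i(t)$ $(i\ge 0,\ t\ge 0)$ are mutually independent and independent of the controller locations. Let $\eta,\rho,\alpha,\gamma>0$ be the transmit power, path-loss constant, path-loss exponent and SINR threshold, let $N_0\ge 0$ be the noise power, and let $$\xi(t)=\frac{\eta\rho|h_0(t)|^2r_0^{-\alpha}}{N_0+\sum_{i\ge1}C_i(t)\,\eta\rho|h_i(t)|^2r_i^{-\alpha}},\qquad S(t)=\begin{cases}1&\text{if } C_0(t)\xi(t)>\gamma,\\0&\text{otherwise,}\end{cases}$$ where the sum in the denominator takes values in $[0,\infty]$ (so $\xi(t)=0$ if it diverges). Consider a restless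 system with state matrix $A\in\mathbb{R}^{n\times n}$ and let $v$ be the degree of the minimal polynomial of $A$. The system is block controllable in block $k$ of $T$ slots if there is a run of at least $v$ ones in $S(kT),\dots,S((k+1)T-1)$. Let $P_{\rm cls}=\mathbb{P}(\xi(t)>\gamma\mid\Phi)$ and $\zeta'(l)=\mathbb{E}[(qP_{\rm cls})^l]$. **Theorem.** For every slot $t$, almost surely $$P_{\rm cls}=e^{-\frac{\gamma N_0}{\eta\rho r_0^{-\alpha}}}\prod_{i\ge1}\left[q\frac{r_0^{-\alpha}}{r_0^{-\alpha}+\gamma r_i^{-\alpha}}+1-q\right].$$ For all $T$ and $k$, the probability that the typical restless system is block controllable in block $k$ is $$P_{\rm RL,cls}=\sum_{l=1}^{\lfloor\frac{T+1}{v+1}\rfloor}(-1)^{l+1}\binom{T-lv}{l-1}\left(\sum_{\ell=0}^{l-1}\binom{l-1}{\ell}(-1)^{\ell}\zeta'(lv+1+\ell)+\frac{T-lv+1}{l}\sum_{\ell=0}^{l}\binom{l}{\ell}(-1)^{\ell}\zeta'(lv+\ell)\right).$$ For every $l\ge0$, $$\zeta'(l)=q^l e^{-\frac{\gamma N_0 l}{\eta\rho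 r_0^{-\alpha}}}\exp\left(-2\pi\lambda\int_0^\infty\left[1-\left(q\frac{r_0^{-\alpha}}{r_0^{-\alpha}+\gamma z^{-\alpha}}+1-q\right)^l\right]z\,\mathrm{d}z\right),$$ where the integral takes values in $[0,\infty]$ and $\exp(-\infty)=0$. If $\alpha>2$, these integrals are finite for all $l\ge0$, and $$\zeta'(l)=q^l e^{-\frac{\gamma N_0 l}{\eta\rho r_0^{-\alpha}}}\exp\left(2\pi\lambda I'(l)\right),\qquad I'(l)=\sum_{\ell=1}^{l}\binom{l}{\ell}\int_0^\infty\left(\frac{-q\gamma z^{-\alpha}}{r_0^{-\alpha}+\gamma z^{-\alpha}}\right)^{\ell}z\,\mathrm{d}z,$$ with all integrals in $I'(l)$ absolutely convergent. -/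

import Mathlib

open MeasureTheory ProbabilityTheory Set
open scoped ENNReal NNReal

namespace PoissonAloha

noncomputable section

/-- The Euclidean plane. -/
abbrev Plane : Type := EuclideanSpace ℝ (Fin 2)

/-- `Φ` is a Poisson point process with intensity measure `Λ` under `P`: a random measure whose
value on a measurable set of finite intensity is Poisson distributed with mean `Λ B`, and whose
values on pairwise disjoint measurable sets are independent. -/
structure IsPoissonProcess {Ω E : Type*} [MeasurableSpace Ω] [MeasurableSpace E]
    (Φ : Ω → Measure E) (Λ : Measure E) (P : Measure Ω) : Prop where
  measurable : Measurable Φ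
  count_law : ∀ B : Set E, MeasurableSet B → Λ B ≠ ∞ →
    P.map (fun ω => Φ ω B) =
      (poissonMeasure (Λ B).toNNReal).map (fun n : ℕ => (n : ℝ≥0∞))
  indep : ∀ (m : ℕ) (B : Fin m → Set E), (∀ j, MeasurableSet (B j)) →
    Pairwise (fun j j' => Disjoint (B j) (B j')) →
    iIndepFun (fun j ω => Φ ω (B j)) P

/-- The random objects of the network, seen from the typical actuator at the origin.
Controller `0` is the typical controller; the controllers `1, 2, …` are the interferers. -/
structure Network (Ω : Type*) where
  /-- location of controller `i` -/
  X : ℕ → Ω → Plane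
  /-- fading coefficient at time `t` between controller `i` and the typical actuator -/
  h : ℕ → ℕ → Ω → ℂ
  /-- channel access state: whether controller `i` transmits at time `t` -/
  C : ℕ → ℕ → Ω → Fin 2

namespace Network

variable {Ω : Type*} (N : Network Ω)

/-- Distance of controller `i` from the typical actuator. -/
def r (i : ℕ) (ω : Ω) : ℝ := ‖N.X i ω‖

/-- The point process of the controllers other than the typical one, as a counting measure. -/
def Φ (ω : Ω) : Measure Plane := Measure.sum fun i : ℕ => Measure.dirac (N.X (i + 1) ω)

/-- The sigma-algebra generated by the point process. -/
abbrev sigmaΦ : MeasurableSpace Ω := MeasurableSpace.comap N.Φ inferInstance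

/-- Received power at the typical actuator from controller `i` at time `t`, when that controller
transmits. -/
def power (η ρ α : ℝ) (i t : ℕ) (ω : Ω) : ℝ :=
  η * ρ * ‖N.h i t ω‖ ^ 2 * N.r i ω ^ (-α)

/-- The interference at time `t`, with values in `[0, ∞]` (the sum may diverge). -/
def interference (η ρ α : ℝ) (t : ℕ) (ω : Ω) : ℝ≥0∞ :=
  ∑' i : ℕ, ((N.C (i + 1) t ω : ℕ) : ℝ≥0∞) * ENNReal.ofReal (N.power η ρ α (i + 1) t ω)

/-- The SINR at the typical actuator at time `t`. -/
def sinr (η ρ α N₀ : ℝ) (t : ℕ) (ω : Ω) : ℝ≥0∞ :=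
  ENNReal.ofReal (N.power η ρ α 0 t ω) / (ENNReal.ofReal N₀ + N.interference η ρ α t ω)

open Classical in
/-- The success indicator `S(t)` of the typical controller. -/
def S (η ρ α N₀ γ : ℝ) (t : ℕ) (ω : Ω) : Fin 2 :=
  if ENNReal.ofReal γ < ((N.C 0 t ω : ℕ) : ℝ≥0∞) * N.sinr η ρ α N₀ t ω then 1 else 0

/-- The conditional success probability `P(ξ(t) > γ | Φ)` of a transmission of the typical
controller at time `t`, given the point process. -/
def condSuccess [MeasurableSpace Ω] (P : Measure Ω) (η ρ α N₀ γ : ℝ) (t : ℕ) : Ω → ℝ :=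
  P⟦{ω | ENNReal.ofReal γ < N.sinr η ρ α N₀ t ω} | N.sigmaΦ⟧

/-- The moment `ζ'(l) = E[(q P_cls)^l]`. -/
def moment [MeasurableSpace Ω] (P : Measure Ω) (η ρ α N₀ γ q : ℝ) (t l : ℕ) : ℝ :=
  ∫ ω, (q * N.condSuccess P η ρ α N₀ γ t ω) ^ l ∂P

/-- The Poisson network under classical ALOHA: the interferers form a homogeneous Poisson point
process of intensity `lam` in the plane, the typical controller is at distance `r₀`, the fading is
independent over links and slots with exponentially distributed power of mean one (Rayleigh fading),
each controller transmits in each slot with probability `q` independently of everything else, and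
locations, fading and channel access are independent. -/
structure IsClassicalAloha [MeasurableSpace Ω] (P : Measure Ω) (lam q r₀ : ℝ) : Prop where
  measurable_X : ∀ i, Measurable (N.X i)
  measurable_h : ∀ i t, Measurable (N.h i t)
  measurable_C : ∀ i t, Measurable (N.C i t)
  typical : ∀ ω, N.r 0 ω = r₀
  poisson : IsPoissonProcess N.Φ (ENNReal.ofReal lam • (volume : Measure Plane)) P
  fading_law : ∀ i t, HasLaw (fun ω => ‖N.h i t ω‖ ^ 2) (expMeasure 1) P
  access_law : ∀ i t, P {ω | N.C i t ω = 1} = ENNReal.ofReal q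
  indep_fading : iIndepFun (fun (p : ℕ × ℕ) ω => N.h p.1 p.2 ω) P
  indep_access : iIndepFun (fun (p : ℕ × ℕ) ω => N.C p.1 p.2 ω) P
  indep_fading_access :
    IndepFun (fun ω (p : ℕ × ℕ) => N.h p.1 p.2 ω) (fun ω (p : ℕ × ℕ) => N.C p.1 p.2 ω) P
  indep_locations :
    IndepFun (fun ω (i : ℕ) => N.X i ω)
      (fun ω => ((fun p : ℕ × ℕ => N.h p.1 p.2 ω), (fun p : ℕ × ℕ => N.C p.1 p.2 ω))) P

end Network

/-- The restless system with state matrix `A` is block controllable in block `k` (of `T` slots) for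
the success sequence `s`: there is a run of at least `v` ones among `s (kT), …, s ((k+1)T - 1)`, where
`v` is the degree of the minimal polynomial of `A`. -/
def BlockControllable {n : ℕ} (A : Matrix (Fin n) (Fin n) ℝ) (T k : ℕ) (s : ℕ → Fin 2) : Prop :=
  ∃ a : ℕ, a + (minpoly ℝ A).natDegree ≤ T ∧
    ∀ j < (minpoly ℝ A).natDegree, s (k * T + a + j) = 1

/-- The alternating de Moivre sum in the moments `z`. -/
def deMoivreSum (z : ℕ → ℝ) (T v : ℕ) : ℝ :=
  ∑ l ∈ Finset.Icc 1 ((T + 1) / (v + 1)), (-1 : ℝ) ^ (l + 1) * ((T - l * v).choose (l - 1) : ℝ) *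
    ((∑ j ∈ Finset.range l, ((l - 1).choose j : ℝ) * (-1) ^ j * z (l * v + 1 + j)) +
      ((T : ℝ) - l * v + 1) / l *
        ∑ j ∈ Finset.range (l + 1), (l.choose j : ℝ) * (-1) ^ j * z (l * v + j))

/-- `q r₀^{-α} / (r₀^{-α} + γ z^{-α}) + 1 - q`. -/
def factor (q r₀ γ α z : ℝ) : ℝ :=
  q * (r₀ ^ (-α) / (r₀ ^ (-α) + γ * z ^ (-α))) + 1 - q

/-- `∫₀^∞ (1 - factor(z)^l) z dz`, with values in `[0, ∞]`. -/
def pgflIntegral (q r₀ γ α : ℝ) (l : ℕ) : ℝ≥0∞ :=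
  ∫⁻ z in Ioi (0 : ℝ), ENNReal.ofReal ((1 - factor q r₀ γ α z ^ l) * z)

/-- `(- q γ z^{-α} / (r₀^{-α} + γ z^{-α}))^j z`. -/
def expansionIntegrand (q r₀ γ α : ℝ) (j : ℕ) (z : ℝ) : ℝ :=
  (-(q * γ * z ^ (-α)) / (r₀ ^ (-α) + γ * z ^ (-α))) ^ j * z

end

end PoissonAloha

open PoissonAloha

/-! Freeze the locations. What remains random is fading and access, independent of the locations and
fresh in every slot. The event `ξ > γ` says that the exponential variable `|h₀|²` exceeds an affine
function of the interference, so its probability is the Laplace transform of that function. This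
factors over the interferers into the noise term times the product of `factor`
(`measure_goodEvent_freeze`). The value depends on the locations only through `Φ`, hence is `P_cls`
(`condSuccess_ae_eq`).

Still with frozen locations, the successes in distinct slots are independent with probability `q
P_cls`. The probability of a run of `v` successes is then de Moivre's polynomial in `q P_cls`,
proved by decomposing according to the end of the first run (`measureReal_runEvent`). Averaging over
the locations is linear in the powers and turns them into moments (`integral_deMoivreSum`).

Finally `P_cls ^ l` is, up to the noise term, `exp (-∑ l * logLoss)`, so the moments are values of
the Laplace functional of the Poisson process (`IsPoissonProcess.lintegral_expNeg`), evaluated in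
polar coordinates. Exponents live in `[0, ∞]` with `e^{-∞} = 0`, so divergent interference,
vanishing products and infinite integrals need no separate treatment. -/

namespace PoissonAloha

open Filter Topology

/-! ### The exponential `e^{-x}` on `[0, ∞]` -/

/-- The function `x ↦ e^{-x}` on `[0, ∞]`, with `e^{-∞} = 0`. -/
noncomputable def expNeg (x : ℝ≥0∞) : ℝ≥0∞ := EReal.exp (-(x : EReal))

@[simp] lemma expNeg_zero : expNeg 0 = 1 := by simp [expNeg]

@[simp] lemma expNeg_top : expNeg ∞ = 0 := by simp [expNeg]

lemma expNeg_add (x y : ℝ≥0∞) : expNeg (x + y) = expNeg x * expNeg y := by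
  simp only [expNeg, EReal.exp_neg, EReal.coe_ennreal_add, EReal.exp_add]
  refine ENNReal.mul_inv (Or.inl ?_) (Or.inr ?_)
  · simp
  · simp

lemma expNeg_ofReal {x : ℝ} (hx : 0 ≤ x) :
    expNeg (ENNReal.ofReal x) = ENNReal.ofReal (Real.exp (-x)) := by
  rw [expNeg, EReal.coe_ennreal_ofReal, max_eq_left hx, ← EReal.coe_neg, EReal.exp_coe]

lemma expNeg_antitone : Antitone expNeg := fun x y h => by
  simpa [expNeg] using h

lemma expNeg_le_one (x : ℝ≥0∞) : expNeg x ≤ 1 := by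
  simpa using expNeg_antitone (zero_le (a := x))

lemma expNeg_ne_top (x : ℝ≥0∞) : expNeg x ≠ ∞ := ((expNeg_le_one x).trans_lt (by simp)).ne

lemma continuous_expNeg : Continuous expNeg := by
  unfold expNeg
  exact ENNReal.continuous_exp.comp (continuous_neg.comp continuous_coe_ennreal_ereal)

@[fun_prop]
lemma measurable_expNeg : Measurable expNeg := continuous_expNeg.measurable

lemma expNeg_sum {ι : Type*} (s : Finset ι) (f : ι → ℝ≥0∞) :
    expNeg (∑ i ∈ s, f i) = ∏ i ∈ s, expNeg (f i) := by
  classical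
  induction s using Finset.induction_on with
  | empty => simp
  | insert a s ha ih => rw [Finset.sum_insert ha, Finset.prod_insert ha, expNeg_add, ih]

lemma expNeg_nat_mul (n : ℕ) (x : ℝ≥0∞) : expNeg (n * x) = expNeg x ^ n := by
  simpa using expNeg_sum (Finset.range n) (fun _ => x)

lemma expNeg_toReal {x : ℝ≥0∞} (hx : x ≠ ∞) : (expNeg x).toReal = Real.exp (-x.toReal) := by
  conv_lhs => rw [← ENNReal.ofReal_toReal hx]
  rw [expNeg_ofReal ENNReal.toReal_nonneg, ENNReal.toReal_ofReal (Real.exp_pos _).le]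

/-! ### Laplace functional of a Poisson process and polar coordinates -/

/-- The Laplace transform of the Poisson distribution. -/
lemma lintegral_expNeg_mul_poissonMeasure (m : ℝ≥0) {c : ℝ≥0∞} (hc : c ≠ ∞) :
    ∫⁻ n : ℕ, expNeg (c * n) ∂(poissonMeasure m) = expNeg (m * (1 - expNeg c)) := by
  lift c to ℝ≥0 using hc
  set x : ℝ := Real.exp (-c) with hx
  have hx1 : x ≤ 1 := by simp [hx]
  have hxc : expNeg c = ENNReal.ofReal x := by
    rw [← ENNReal.ofReal_coe_nnreal, expNeg_ofReal c.coe_nonneg]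
  have hm : (m : ℝ≥0∞) * (1 - expNeg c) = ENNReal.ofReal (m * (1 - x)) := by
    rw [hxc, ENNReal.ofReal_mul m.coe_nonneg, ENNReal.ofReal_sub _ (Real.exp_pos _).le]
    simp [hx]
  -- The exponential series at `m * x`, multiplied by `e^{-m}`.
  have hs : HasSum (fun n : ℕ => Real.exp (-m) * m ^ n / n.factorial * x ^ n)
      (Real.exp (-(m * (1 - x)))) := by
    convert! (NormedSpace.expSeries_div_hasSum_exp (m * x : ℝ)).mul_left (Real.exp (-m)) using 1
    · ext n; rw [mul_pow]; ring
    · rw [← Real.exp_eq_exp_ℝ, ← Real.exp_add]; ring_nf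
  rw [hm, expNeg_ofReal (mul_nonneg m.coe_nonneg (by linarith)), poissonMeasure,
    lintegral_sum_measure, ← hs.tsum_eq,
    ENNReal.ofReal_tsum_of_nonneg (fun n => by positivity) hs.summable]
  refine tsum_congr fun n => ?_
  rw [lintegral_smul_measure, lintegral_dirac, mul_comm (c : ℝ≥0∞), expNeg_nat_mul, hxc,
    smul_eq_mul, ← ENNReal.ofReal_pow (Real.exp_pos _).le, ← ENNReal.ofReal_mul (by positivity)]

section Laplace

variable {Ω E : Type*} [MeasurableSpace Ω] [MeasurableSpace E]
  {Φ : Ω → Measure E} {Λ : Measure E} {P : Measure Ω}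

lemma IsPoissonProcess.lintegral_expNeg_count (hΦ : IsPoissonProcess Φ Λ P) {B : Set E}
    (hB : MeasurableSet B) (hΛ : Λ B ≠ ∞) {c : ℝ≥0∞} (hc : c ≠ ∞) :
    ∫⁻ ω, expNeg (c * Φ ω B) ∂P = expNeg ((1 - expNeg c) * Λ B) := by
  have hm : Measurable fun x : ℝ≥0∞ => expNeg (c * x) := by fun_prop
  have hΦB : Measurable fun ω => Φ ω B := (Measure.measurable_coe hB).comp hΦ.measurable
  rw [← lintegral_map (f := fun x : ℝ≥0∞ => expNeg (c * x)) (g := fun ω => Φ ω B) hm hΦB,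
    hΦ.count_law B hB hΛ, lintegral_map hm (by fun_prop),
    lintegral_expNeg_mul_poissonMeasure _ hc, ENNReal.coe_toNNReal hΛ, mul_comm]

/-- The level sets are disjoint, so their counts are independent and the transform factors into
Poisson transforms. The level `0` may have infinite intensity, but contributes the factor `1` on
both sides. -/
lemma IsPoissonProcess.lintegral_expNeg_simpleFunc [IsProbabilityMeasure P]
    (hΦ : IsPoissonProcess Φ Λ P) (f : SimpleFunc E ℝ≥0∞)
    (hf : ∀ x, f x ≠ ∞) (hfin : ∀ c ≠ 0, Λ (f ⁻¹' {c}) ≠ ∞) :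
    ∫⁻ ω, expNeg (∫⁻ x, f x ∂(Φ ω)) ∂P = expNeg (∫⁻ x, (1 - expNeg (f x)) ∂Λ) := by
  have hr : ∫⁻ x, (1 - expNeg (f x)) ∂Λ = ∑ c ∈ f.range, (1 - expNeg c) * Λ (f ⁻¹' {c}) := by
    rw [← SimpleFunc.map_lintegral (fun c => 1 - expNeg c) f, ← SimpleFunc.lintegral_eq_lintegral]
    rfl
  have hl : ∀ ω, expNeg (∫⁻ x, f x ∂(Φ ω)) =
      ∏ c ∈ f.range, expNeg (c * Φ ω (f ⁻¹' {c})) := fun ω => by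
    rw [SimpleFunc.lintegral_eq_lintegral, SimpleFunc.lintegral, expNeg_sum]
  rw [hr, expNeg_sum, lintegral_congr hl]
  let e := f.range.equivFin
  have hind := hΦ.indep _ (fun j => f ⁻¹' {(e.symm j : ℝ≥0∞)}) (fun j => f.measurableSet_preimage _)
    (fun i j hij => Disjoint.preimage _ (by simpa [Subtype.ext_iff] using hij))
  have hind' := hind.comp (fun j x => expNeg ((e.symm j : ℝ≥0∞) * x)) (fun j => by fun_prop)
  have key := lintegral_prod_eq_prod_lintegral_of_indepFun Finset.univ _ hind' (fun j => by
    have hΦB : Measurable fun ω => Φ ω (f ⁻¹' {(e.symm j : ℝ≥0∞)}) :=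
      (Measure.measurable_coe (f.measurableSet_preimage _)).comp hΦ.measurable
    exact Measurable.comp (by fun_prop) hΦB)
  have hprod : ∀ g : ℝ≥0∞ → ℝ≥0∞, ∏ j, g (e.symm j) = ∏ c ∈ f.range, g c := fun g => by
    rw [e.symm.prod_comp (fun c : f.range => g c), Finset.prod_coe_sort]
  simp only [Function.comp_apply] at key
  rw [lintegral_congr fun ω => (hprod (fun c => expNeg (c * Φ ω (f ⁻¹' {c}))))] at key
  rw [key, hprod (fun c => ∫⁻ ω, expNeg (c * Φ ω (f ⁻¹' {c})) ∂P)]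
  refine Finset.prod_congr rfl fun c hc => ?_
  obtain rfl | h0 := eq_or_ne c 0
  · simp
  · obtain ⟨x, rfl⟩ := SimpleFunc.mem_range.1 hc
    exact hΦ.lintegral_expNeg_count (f.measurableSet_preimage _) (hfin _ h0) (hf x)

/-- The Laplace functional of a Poisson process. -/
theorem IsPoissonProcess.lintegral_expNeg [IsProbabilityMeasure P] [SigmaFinite Λ]
    (hΦ : IsPoissonProcess Φ Λ P) {f : E → ℝ≥0∞} (hf : Measurable f) :
    ∫⁻ ω, expNeg (∫⁻ x, f x ∂(Φ ω)) ∂P = expNeg (∫⁻ x, (1 - expNeg (f x)) ∂Λ) := by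
  -- Cutting off to the spanning sets gives the nonzero levels finite intensity; `eapprox` keeps the
  -- values finite.
  let g : ℕ → SimpleFunc E ℝ≥0∞ := fun n => (SimpleFunc.eapprox f n).restrict (spanningSets Λ n)
  have hg : ∀ n x, g n x = (spanningSets Λ n).indicator (SimpleFunc.eapprox f n) x := fun n x => by
    rw [← SimpleFunc.restrict_apply _ (measurableSet_spanningSets Λ n)]
  have hmono : ∀ x, Monotone fun n => g n x := fun x m n hmn => by
    simp only [hg]
    refine (indicator_le_indicator_of_subset (monotone_spanningSets Λ hmn) (by simp) x).trans ?_
    exact indicator_le_indicator (SimpleFunc.monotone_eapprox f hmn x)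
  have hlim : ∀ x, Tendsto (fun n => g n x) atTop (𝓝 (f x)) := fun x => by
    have h := tendsto_atTop_iSup fun m n hmn => (SimpleFunc.monotone_eapprox f hmn x :)
    rw [SimpleFunc.iSup_eapprox_apply hf x] at h
    refine h.congr' ?_
    filter_upwards [eventually_ge_atTop (spanningSetsIndex Λ x)] with n hn
    rw [hg, indicator_of_mem (mem_spanningSets_of_index_le _ _ hn)]
  have hstep : ∀ n, ∫⁻ ω, expNeg (∫⁻ x, g n x ∂(Φ ω)) ∂P
      = expNeg (∫⁻ x, (1 - expNeg (g n x)) ∂Λ) := fun n => by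
    refine hΦ.lintegral_expNeg_simpleFunc _ (fun x => ?_) (fun c hc => ?_)
    · rw [hg]
      refine (indicator_le_self' (by simp) x).trans_lt ?_ |>.ne
      exact SimpleFunc.eapprox_lt_top f n x
    · refine ((measure_mono fun x hx => ?_).trans_lt (measure_spanningSets_lt_top Λ n)).ne
      by_contra hx'
      apply hc
      rw [← show g n x = c from hx, hg, indicator_of_notMem hx']
  have hΦf : ∀ n, Measurable fun ω => expNeg (∫⁻ x, g n x ∂(Φ ω)) := fun n =>
    measurable_expNeg.comp ((Measure.measurable_lintegral (g n).measurable).comp hΦ.measurable)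
  have hl : Tendsto (fun n => ∫⁻ ω, expNeg (∫⁻ x, g n x ∂(Φ ω)) ∂P) atTop
      (𝓝 (∫⁻ ω, expNeg (∫⁻ x, f x ∂(Φ ω)) ∂P)) := by
    -- `expNeg` reverses monotonicity, so the outer limit uses domination by the constant `1`; the
    -- inner one is monotone.
    refine tendsto_lintegral_of_dominated_convergence (fun _ => 1) hΦf
      (fun n => ae_of_all _ fun ω => expNeg_le_one _) (by simp) (ae_of_all _ fun ω => ?_)
    exact (continuous_expNeg.tendsto _).comp (lintegral_tendsto_of_tendsto_of_monotone
      (fun n => (g n).measurable.aemeasurable) (ae_of_all _ hmono) (ae_of_all _ hlim))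
  have hr : Tendsto (fun n => expNeg (∫⁻ x, (1 - expNeg (g n x)) ∂Λ)) atTop
      (𝓝 (expNeg (∫⁻ x, (1 - expNeg (f x)) ∂Λ))) := by
    refine (continuous_expNeg.tendsto _).comp (lintegral_tendsto_of_tendsto_of_monotone
      (fun n => (Measurable.sub measurable_const
        (measurable_expNeg.comp (g n).measurable)).aemeasurable)
      (ae_of_all _ fun x m n hmn => ?_) (ae_of_all _ fun x => ?_))
    · exact tsub_le_tsub_left (expNeg_antitone (hmono x hmn)) 1
    · exact ENNReal.Tendsto.sub tendsto_const_nhds ((continuous_expNeg.tendsto _).comp (hlim x))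
        (Or.inl (by simp))
  exact tendsto_nhds_unique hl (by simpa only [hstep] using hr)

end Laplace

/-- Integration of a radial function over the plane in polar coordinates. -/
lemma lintegral_norm_plane {g : ℝ → ℝ≥0∞} (hg : Measurable g) :
    ∫⁻ x : Plane, g ‖x‖ = ENNReal.ofReal (2 * Real.pi) *
      ∫⁻ z in Ioi (0 : ℝ), ENNReal.ofReal z * g z := by
  have h1 : ∫⁻ x : Plane, g ‖x‖ = ∫⁻ z : ℂ, g ‖z‖ := by
    rw [← (Complex.orthonormalBasisOneI.repr.measurePreserving).lintegral_comp
      (f := fun x : Plane => g ‖x‖) (by fun_prop)]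
    simp
  have h2 : ∀ p ∈ polarCoord.target, ENNReal.ofReal p.1 • g ‖Complex.polarCoord.symm p‖ =
      ENNReal.ofReal p.1 * g p.1 := fun p hp => by
    have hp1 : 0 < p.1 := by simpa using hp.1
    rw [Complex.norm_polarCoord_symm, abs_of_pos hp1, smul_eq_mul]
  rw [h1, ← Complex.lintegral_comp_polarCoord_symm,
    setLIntegral_congr_fun polarCoord.open_target.measurableSet h2, polarCoord_target,
    Measure.volume_eq_prod, ← Measure.prod_restrict, lintegral_prod _ (by fun_prop)]
  simp only [lintegral_const, Measure.restrict_apply MeasurableSet.univ, univ_inter,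
    Real.volume_Ioo]
  rw [lintegral_mul_const _ (by fun_prop), mul_comm]
  congr 2
  ring

/-! ### Algebra of de Moivre's formula -/

/-- The weight of the `i`-th term in de Moivre's formula for success runs of length `v` in `T`
trials with failure probability `Q`. -/
def runWeight (Q : ℝ) (v i T : ℕ) : ℝ :=
  if (i + 1) * v ≤ T then
    ((T - (i + 1) * v).choose i : ℝ) + Q * ((T - (i + 1) * v).choose (i + 1) : ℝ)
  else 0

/-- The partial sum of `N` terms of de Moivre's formula. -/
def runSum (p : ℝ) (v N T : ℕ) : ℝ :=
  ∑ i ∈ Finset.range N, (-1) ^ i * p ^ ((i + 1) * v) * (1 - p) ^ i * runWeight (1 - p) v i T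

lemma runWeight_zero_succ (Q : ℝ) {v T : ℕ} (h : v ≤ T) :
    runWeight Q v 0 (T + 1) - runWeight Q v 0 T = Q := by
  have h' : v ≤ T + 1 := h.trans (Nat.le_succ T)
  simp only [runWeight, zero_add, one_mul, if_pos h, if_pos h', Nat.choose_zero_right,
    Nat.choose_one_right, Nat.cast_sub h, Nat.cast_sub h']
  push_cast
  ring

/-- Pascal's rule for both binomials. In the boundary case `w + v = T + 1` the new weight is in
range but equals `0`, so the cutoff does not disturb the recursion. -/
lemma runWeight_succ_succ (Q : ℝ) {v T : ℕ} (i : ℕ) (h : v ≤ T) :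
    runWeight Q v (i + 1) (T + 1) - runWeight Q v (i + 1) T = runWeight Q v i (T - v) := by
  have hv : (i + 1 + 1) * v = (i + 1) * v + v := by ring
  simp only [runWeight]
  rw [hv]
  generalize (i + 1) * v = w
  rcases lt_trichotomy (w + v) (T + 1) with h1 | h1 | h1
  · obtain ⟨m, rfl⟩ : ∃ m, T = w + v + m := ⟨T - (w + v), by omega⟩
    rw [if_pos (by omega), if_pos (by omega), if_pos (by omega),
      show w + v + m + 1 - (w + v) = m + 1 by omega, show w + v + m - (w + v) = m by omega,
      show w + v + m - v - w = m by omega, Nat.choose_succ_succ, Nat.choose_succ_succ m (i + 1)]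
    push_cast
    ring
  · rw [if_pos (by omega), if_neg (by omega), if_neg (by omega), ← h1]
    simp
  · rw [if_neg (by omega), if_neg (by omega), if_neg (by omega)]
    simp

/-- Both binomials vanish here, so `runSum` does not depend on its number of terms once that reaches
`(T + 1) / (v + 1)`. -/
lemma runWeight_eq_zero (Q : ℝ) {v i T : ℕ} (h : T + 1 < (i + 1) * (v + 1)) :
    runWeight Q v i T = 0 := by
  unfold runWeight
  have h' : T < (i + 1) * v + i := by linarith
  split_ifs with h1
  · rw [Nat.choose_eq_zero_of_lt (by omega), Nat.choose_eq_zero_of_lt (by omega)]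
    simp
  · rfl

lemma runSum_of_lt (p : ℝ) {v T : ℕ} (N : ℕ) (h : T < v) : runSum p v N T = 0 := by
  refine Finset.sum_eq_zero fun i _ => ?_
  rw [runWeight, if_neg (by nlinarith), mul_zero]

lemma runSum_self (p : ℝ) (v N : ℕ) : runSum p v (N + 1) v = p ^ v := by
  rw [runSum, Finset.sum_range_succ', Finset.sum_eq_zero fun i _ => ?_]
  · simp [runWeight]
  · rw [runWeight_eq_zero _ (by nlinarith), mul_zero]

/-- This mirrors the first-run decomposition in `runEvent_succ_diff`. In the increment from `T` to
`T + 1`, the term `i = 0` gives the `1` and the terms `i + 1` give, after the shift, minus the sum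
at `T - v`. -/
lemma runSum_succ (p : ℝ) {v T : ℕ} (N : ℕ) (h : v ≤ T) :
    runSum p v (N + 1) (T + 1) =
      runSum p v (N + 1) T + (1 - runSum p v N (T - v)) * ((1 - p) * p ^ v) := by
  rw [← sub_eq_iff_eq_add']
  simp only [runSum]
  rw [← Finset.sum_sub_distrib, Finset.sum_range_succ', one_sub_mul, Finset.sum_mul,
    sub_eq_add_neg ((1 - p) * p ^ v), ← Finset.sum_neg_distrib, add_comm]
  congr 1
  · rw [← mul_sub, runWeight_zero_succ _ h]
    simp
    ring
  · refine Finset.sum_congr rfl fun i _ => ?_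
    rw [← mul_sub, runWeight_succ_succ _ i h]
    ring

lemma sum_choose_neg_pow (p : ℝ) (m n : ℕ) :
    ∑ j ∈ Finset.range (n + 1), (n.choose j : ℝ) * (-1) ^ j * p ^ (m + j) =
      p ^ m * (1 - p) ^ n := by
  rw [sub_eq_neg_add, add_pow, Finset.mul_sum]
  refine Finset.sum_congr rfl fun j _ => ?_
  rw [neg_pow p, pow_add]
  ring

/-- For pure powers the inner alternating sums collapse by the binomial theorem. With `l = i + 1`
and `m = T - l * v`, the fraction `(m + 1) / l` turns `m.choose i` into `(m + 1).choose (i + 1)`;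
Pascal's rule then yields `runWeight`. -/
lemma deMoivreSum_pow (p : ℝ) (T v : ℕ) :
    deMoivreSum (fun n => p ^ n) T v = runSum p v (T + 1) T := by
  have hL : (T + 1) / (v + 1) ≤ T + 1 := Nat.div_le_self _ _
  rw [runSum, ← Finset.sum_subset (Finset.range_mono hL) fun i _ hi => ?_, deMoivreSum,
    show Finset.Icc 1 ((T + 1) / (v + 1)) = Finset.Ico (0 + 1) ((T + 1) / (v + 1) + 1) by
      ext; simp, ← Finset.sum_Ico_add', ← Finset.range_eq_Ico]
  · refine Finset.sum_congr rfl fun i hi => ?_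
    have hl2 : i + 1 ≤ (T + 1) / (v + 1) := Finset.mem_range.1 hi
    rw [Nat.le_div_iff_mul_le (Nat.succ_pos v)] at hl2
    have hiT : (i + 1) * v + i ≤ T := by linarith
    obtain ⟨m, rfl⟩ : ∃ m, T = (i + 1) * v + m := ⟨T - (i + 1) * v, by omega⟩
    have hp := Nat.add_one_mul_choose_eq m i
    have hp' : ((m : ℝ) + 1) * m.choose i = (m.choose i + m.choose (i + 1)) * (i + 1) := by
      exact_mod_cast (by rw [Nat.choose_succ_succ] at hp; exact hp)
    have hm : (((i + 1) * v + m : ℕ) : ℝ) - ((i + 1 : ℕ) : ℝ) * v + 1 = m + 1 := by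
      push_cast; ring
    have hc : (m.choose i : ℝ) * (((m : ℝ) + 1) / ((i + 1 : ℕ) : ℝ)) =
        m.choose i + m.choose (i + 1) := by
      push_cast
      rw [← mul_div_assoc, div_eq_iff (by positivity), mul_comm, hp']
    simp only [Nat.add_sub_cancel, hm]
    rw [sum_choose_neg_pow, sum_choose_neg_pow p _ (i + 1), runWeight, if_pos (by omega),
      show (i + 1) * v + m - (i + 1) * v = m by omega]
    calc _ = (-1 : ℝ) ^ i * (p ^ ((i + 1) * v) * (1 - p) ^ i) * (m.choose i * p +
          (m.choose i * (((m : ℝ) + 1) / ((i + 1 : ℕ) : ℝ))) * (1 - p)) := by ring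
      _ = _ := by rw [hc]; ring
  · have : (T + 1) / (v + 1) < i + 1 := by simpa [Nat.lt_succ_iff] using hi
    rw [runWeight_eq_zero _ ((Nat.div_lt_iff_lt_mul (Nat.succ_pos v)).1 this), mul_zero]

/-! ### Runs of successes in independent trials -/

section Runs

variable {Ω : Type*}

/-- The event that there is a run of `v` consecutive occurrences among the first `T` of the events
`E 0, E 1, …`. -/
def runEvent (E : ℕ → Set Ω) (v T : ℕ) : Set Ω :=
  {ω | ∃ a, a + v ≤ T ∧ ∀ j < v, ω ∈ E (a + j)}

lemma runEvent_mono (E : ℕ → Set Ω) (v : ℕ) : Monotone (runEvent E v) :=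
  fun _ _ h _ ⟨a, ha, hE⟩ => ⟨a, ha.trans h, hE⟩

lemma runEvent_of_lt (E : ℕ → Set Ω) {v T : ℕ} (h : T < v) : runEvent E v T = ∅ := by
  ext ω
  simp only [runEvent, mem_ofPred_eq, mem_empty_iff_false, iff_false]
  rintro ⟨a, ha, -⟩
  omega

lemma runEvent_self (E : ℕ → Set Ω) (v : ℕ) : runEvent E v v = ⋂ j ∈ Finset.range v, E (0 + j) := by
  ext ω
  simp only [runEvent, mem_ofPred_eq, mem_iInter, Finset.mem_range]
  constructor
  · rintro ⟨a, ha, h⟩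
    obtain rfl : a = 0 := by omega
    exact h
  · exact fun h => ⟨0, by omega, h⟩

/-- A run that appears only with the last trial must occupy exactly the last `v` trials. It is
preceded by a failure at `T - v`, and no run fits before that failure. The three conditions involve
disjoint blocks of trials. -/
lemma runEvent_succ_diff (E : ℕ → Set Ω) {v T : ℕ} (h : v ≤ T) :
    runEvent E v (T + 1) \ runEvent E v T =
      ((runEvent E v (T - v))ᶜ ∩ (E (T - v))ᶜ) ∩ ⋂ j ∈ Finset.range v, E (T - v + 1 + j) := by
  ext ω
  simp only [Set.mem_sdiff, mem_inter_iff, mem_compl_iff, mem_iInter, Finset.mem_range]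
  constructor
  · rintro ⟨⟨a, ha, hE⟩, hT⟩
    have haT : a = T - v + 1 := by
      by_contra hne
      exact hT ⟨a, by omega, hE⟩
    subst haT
    refine ⟨⟨fun h' => hT (runEvent_mono E v (Nat.sub_le _ _) h'), fun h' => hT ?_⟩, hE⟩
    refine ⟨T - v, by omega, fun j hj => ?_⟩
    obtain _ | j := j
    · exact h'
    · have := hE j (by omega)
      rwa [add_right_comm] at this
  · rintro ⟨⟨h1, h2⟩, h3⟩
    refine ⟨⟨T - v + 1, by omega, h3⟩, ?_⟩
    rintro ⟨a, ha, hE⟩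
    by_cases hav : a + v ≤ T - v
    · exact h1 ⟨a, hav, hE⟩
    · apply h2
      have := hE (T - v - a) (by omega)
      rwa [show a + (T - v - a) = T - v by omega] at this

lemma measurableSet_runEvent {F : ℕ → MeasurableSpace Ω} {E : ℕ → Set Ω}
    (hF : Monotone F) (hE : ∀ k, MeasurableSet[F (k + 1)] (E k))
    (v T : ℕ) : MeasurableSet[F T] (runEvent E v T) := by
  have : runEvent E v T = ⋃ a, ⋃ (_ : a + v ≤ T), ⋂ j, ⋂ (_ : j < v), E (a + j) := by
    ext ω; simp [runEvent]
  rw [this]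
  refine MeasurableSet.iUnion fun a => MeasurableSet.iUnion fun ha => MeasurableSet.iInter fun j =>
    MeasurableSet.iInter fun hj => hF (by omega) _ (hE (a + j))

lemma measureReal_inter_biInter {mΩ : MeasurableSpace Ω} {P : Measure Ω}
    {F : ℕ → MeasurableSpace Ω} {E : ℕ → Set Ω} {p : ℝ} (hF : Monotone F)
    (hE : ∀ k, MeasurableSet[F (k + 1)] (E k))
    (hind : ∀ k A, MeasurableSet[F k] A → P.real (A ∩ E k) = P.real A * p)
    {k : ℕ} {A : Set Ω} (hA : MeasurableSet[F k] A) (n : ℕ) :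
    P.real (A ∩ ⋂ j ∈ Finset.range n, E (k + j)) = P.real A * p ^ n := by
  have key : MeasurableSet[F (k + n)] (A ∩ ⋂ j ∈ Finset.range n, E (k + j)) ∧
      P.real (A ∩ ⋂ j ∈ Finset.range n, E (k + j)) = P.real A * p ^ n := by
    induction n with
    | zero => simpa using hA
    | succ n ih =>
      have h : A ∩ ⋂ j ∈ Finset.range (n + 1), E (k + j) =
          (A ∩ ⋂ j ∈ Finset.range n, E (k + j)) ∩ E (k + n) := by
        rw [Finset.range_add_one, Finset.set_biInter_insert, inter_comm (E (k + n)), inter_assoc]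
      rw [h, hind _ _ ih.1, ih.2, pow_succ, mul_assoc]
      exact ⟨(hF (by omega) _ ih.1).inter (hE (k + n)), rfl⟩
  exact key.2

/-- De Moivre's formula for the probability of a run of successes in independent trials. -/
theorem measureReal_runEvent {mΩ : MeasurableSpace Ω} {P : Measure Ω} [IsProbabilityMeasure P]
    {F : ℕ → MeasurableSpace Ω} {E : ℕ → Set Ω} {p : ℝ} (hF : Monotone F) (hFle : ∀ k, F k ≤ mΩ)
    (hE : ∀ k, MeasurableSet[F (k + 1)] (E k))
    (hind : ∀ k A, MeasurableSet[F k] A → P.real (A ∩ E k) = P.real A * p) (v T : ℕ) :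
    P.real (runEvent E v T) = deMoivreSum (fun n => p ^ n) T v := by
  rw [deMoivreSum_pow]
  -- The number of terms is left free because `runSum_succ` lowers it by one in the term at `T - v`.
  suffices ∀ T N, T ≤ N → P.real (runEvent E v T) = runSum p v (N + 1) T from this T T le_rfl
  intro T
  induction T using Nat.strong_induction_on with
  | _ T ih =>
    intro N hN
    rcases lt_trichotomy T v with h | rfl | h
    · rw [runEvent_of_lt E h, runSum_of_lt p _ h, measureReal_empty]
    · rw [runSum_self, runEvent_self]
      have := measureReal_inter_biInter (k := 0) hF hE hind MeasurableSet.univ T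
      simpa using this
    · obtain ⟨T, rfl⟩ : ∃ S, T = S + 1 := ⟨T - 1, by omega⟩
      obtain ⟨N, rfl⟩ : ∃ M, N = M + 1 := ⟨N - 1, by omega⟩
      have hvT : v ≤ T := by omega
      have hR := measurableSet_runEvent hF hE v
      rw [runSum_succ p _ hvT, ← ih T (by omega) (N + 1) (by omega),
        ← ih (T - v) (by omega) N (by omega),
        ← measureReal_sdiff_add_inter (s := runEvent E v (T + 1)) (hFle _ _ (hR T)),
        inter_eq_self_of_subset_right (runEvent_mono E v (Nat.le_succ T)),
        add_comm, runEvent_succ_diff E hvT]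
      congr 1
      have hc : MeasurableSet[F (T - v)] (runEvent E v (T - v))ᶜ := (hR _).compl
      rw [measureReal_inter_biInter hF hE hind
        ((hF (Nat.le_succ _) _ hc).inter (hE (T - v)).compl)]
      have h1 := measureReal_sdiff_add_inter (μ := P) (s := (runEvent E v (T - v))ᶜ)
        (hFle _ _ (hE (T - v)))
      rw [hind _ _ hc, sdiff_eq] at h1
      rw [← probReal_compl_eq_one_sub (hFle _ _ (hR _))]
      -- Here `h1` says that `(runEvent E v (T - v))ᶜ` and the failure at `T - v` have joint
      -- probability `P.real (runEvent E v (T - v))ᶜ * (1 - p)`.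
      linear_combination p ^ v * h1

end Runs

/-! ### The factor of one interferer and its integrals -/

section Factor

variable {q r₀ γ α : ℝ}

@[fun_prop]
lemma measurable_factor : Measurable (factor q r₀ γ α) := by
  unfold factor; fun_prop

lemma factor_eq_one_add (hr₀ : 0 < r₀) (hγ : 0 < γ) {z : ℝ} (hz : 0 ≤ z) :
    factor q r₀ γ α z = 1 + -(q * γ * z ^ (-α)) / (r₀ ^ (-α) + γ * z ^ (-α)) := by
  have h : 0 < r₀ ^ (-α) + γ * z ^ (-α) := by positivity
  rw [factor]
  field_simp
  ring

lemma factor_le_one (hq₀ : 0 ≤ q) (hr₀ : 0 < r₀) (hγ : 0 < γ) {z : ℝ} (hz : 0 ≤ z) :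
    factor q r₀ γ α z ≤ 1 := by
  rw [factor_eq_one_add hr₀ hγ hz, neg_div]
  have : 0 ≤ q * γ * z ^ (-α) / (r₀ ^ (-α) + γ * z ^ (-α)) := by positivity
  linarith

lemma factor_pos (hq₀ : 0 ≤ q) (hq₁ : q ≤ 1) (hr₀ : 0 < r₀) (hγ : 0 < γ) {z : ℝ} (hz : 0 ≤ z) :
    0 < factor q r₀ γ α z := by
  have h : 0 < r₀ ^ (-α) / (r₀ ^ (-α) + γ * z ^ (-α)) := by positivity
  rw [factor]
  obtain rfl | hq := hq₁.eq_or_lt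
  · linarith
  · have := mul_nonneg hq₀ h.le
    linarith

/-- The exponent `-log factor(z)`, as an element of `[0, ∞]`. -/
noncomputable def logLoss (q r₀ γ α z : ℝ) : ℝ≥0∞ := ENNReal.ofReal (-Real.log (factor q r₀ γ α z))

@[fun_prop]
lemma measurable_logLoss : Measurable (logLoss q r₀ γ α) := by
  unfold logLoss; fun_prop

lemma expNeg_logLoss (hq₀ : 0 ≤ q) (hq₁ : q ≤ 1) (hr₀ : 0 < r₀) (hγ : 0 < γ) {z : ℝ} (hz : 0 ≤ z) :
    expNeg (logLoss q r₀ γ α z) = ENNReal.ofReal (factor q r₀ γ α z) := by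
  have h := factor_pos (α := α) hq₀ hq₁ hr₀ hγ hz
  rw [logLoss, expNeg_ofReal (neg_nonneg.2 (Real.log_nonpos h.le (factor_le_one hq₀ hr₀ hγ hz))),
    neg_neg, Real.exp_log h]

/-- Partial products are `expNeg` of partial sums, which always converge in `[0, ∞]`. The product
therefore converges unconditionally, possibly to `0`. -/
lemma tprod_factor (hq₀ : 0 ≤ q) (hq₁ : q ≤ 1) (hr₀ : 0 < r₀) (hγ : 0 < γ) {z : ℕ → ℝ}
    (hz : ∀ i, 0 ≤ z i) :
    ∏' i, factor q r₀ γ α (z i) = (expNeg (∑' i, logLoss q r₀ γ α (z i))).toReal := by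
  refine HasProd.tprod_eq ?_
  have h := (ENNReal.tendsto_toReal (expNeg_ne_top _)).comp ((continuous_expNeg.tendsto _).comp
    (ENNReal.summable (f := fun i => logLoss q r₀ γ α (z i))).hasSum)
  refine h.congr fun s => ?_
  simp only [Function.comp_apply, expNeg_sum, ENNReal.toReal_prod]
  refine Finset.prod_congr rfl fun i _ => ?_
  rw [expNeg_logLoss hq₀ hq₁ hr₀ hγ (hz i),
    ENNReal.toReal_ofReal (factor_pos hq₀ hq₁ hr₀ hγ (hz i)).le]

lemma integrableOn_expansionIntegrand (hq₀ : 0 ≤ q) (hq₁ : q ≤ 1) (hr₀ : 0 < r₀) (hγ : 0 < γ)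
    (hα : 2 < α) {j : ℕ} (hj : 1 ≤ j) :
    IntegrableOn (expansionIntegrand q r₀ γ α j) (Ioi 0) := by
  have hmeas : Measurable (expansionIntegrand q r₀ γ α j) := by
    unfold expansionIntegrand; fun_prop
  have hbase : ∀ z : ℝ, 0 < z →
      ‖expansionIntegrand q r₀ γ α j z‖ ≤ q * γ * z ^ (-α) / (r₀ ^ (-α) + γ * z ^ (-α)) * z ∧
      q * γ * z ^ (-α) / (r₀ ^ (-α) + γ * z ^ (-α)) ≤ 1 := fun z hz => by
    have h0 : 0 ≤ q * γ * z ^ (-α) / (r₀ ^ (-α) + γ * z ^ (-α)) := by positivity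
    have h1 : q * γ * z ^ (-α) / (r₀ ^ (-α) + γ * z ^ (-α)) ≤ 1 := by
      rw [div_le_one (by positivity)]
      have := Real.rpow_pos_of_pos hr₀ (-α)
      have : q * (γ * z ^ (-α)) ≤ 1 * (γ * z ^ (-α)) := by gcongr
      linarith
    refine ⟨?_, h1⟩
    rw [expansionIntegrand, norm_mul, norm_pow, neg_div, norm_neg, Real.norm_of_nonneg h0,
      Real.norm_of_nonneg hz.le]
    gcongr
    exact pow_le_of_le_one h0 h1 (by omega)
  -- On `(0, 1]` the integrand is bounded by `1`; beyond `1` it is dominated by a multiple of `z ^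
  -- (1 - α)`, integrable since `α > 2`.
  rw [← Ioc_union_Ioi_eq_Ioi zero_le_one]
  refine IntegrableOn.union ?_ ?_
  · refine Measure.integrableOn_of_bounded (M := 1) (by simp) hmeas.aestronglyMeasurable ?_
    filter_upwards [ae_restrict_mem measurableSet_Ioc] with z hz
    obtain ⟨h1, h2⟩ := hbase z hz.1
    exact h1.trans (mul_le_one₀ h2 hz.1.le hz.2)
  · refine Integrable.mono' (g := fun z => q * γ / r₀ ^ (-α) * z ^ (1 - α))
      ((integrableOn_Ioi_rpow_of_lt (by linarith) one_pos).const_mul _)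
      hmeas.aestronglyMeasurable ?_
    filter_upwards [ae_restrict_mem measurableSet_Ioi] with z hz
    have hz0 : 0 < z := one_pos.trans hz
    refine (hbase z hz0).1.trans ?_
    have hr : q * γ / r₀ ^ (-α) * z ^ (1 - α) = q * γ * z ^ (-α) / r₀ ^ (-α) * z := by
      rw [sub_eq_neg_add, Real.rpow_add_one hz0.ne']
      ring
    rw [hr]
    gcongr
    exact le_add_of_nonneg_right (by positivity)

/-- Binomial expansion of `factor` written as `1` plus a negative term; the summand `j = 0` cancels
the leading `1`. -/
lemma one_sub_factor_pow_mul (hr₀ : 0 < r₀) (hγ : 0 < γ) (l : ℕ) {z : ℝ} (hz : 0 ≤ z) :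
    (1 - factor q r₀ γ α z ^ l) * z =
      -∑ j ∈ Finset.Icc 1 l, (l.choose j : ℝ) * expansionIntegrand q r₀ γ α j z := by
  rw [factor_eq_one_add hr₀ hγ hz, add_comm, add_pow, Finset.range_eq_Ico,
    Finset.sum_eq_sum_Ico_succ_bot (Nat.succ_pos l)]
  simp only [one_pow, mul_one, pow_zero, Nat.choose_zero_right, Nat.cast_one,
    sub_add_cancel_left, neg_mul, Finset.sum_mul, expansionIntegrand]
  congr 1
  exact Finset.sum_congr (by ext; simp) fun j _ => by ring

lemma pgflIntegral_eq_ofReal (hq₀ : 0 ≤ q) (hq₁ : q ≤ 1) (hr₀ : 0 < r₀) (hγ : 0 < γ)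
    (hα : 2 < α) (l : ℕ) :
    pgflIntegral q r₀ γ α l = ENNReal.ofReal (-∑ j ∈ Finset.Icc 1 l, (l.choose j : ℝ) *
      ∫ z in Ioi (0 : ℝ), expansionIntegrand q r₀ γ α j z) ∧
    0 ≤ -∑ j ∈ Finset.Icc 1 l, (l.choose j : ℝ) *
      ∫ z in Ioi (0 : ℝ), expansionIntegrand q r₀ γ α j z := by
  have hint : ∀ j ∈ Finset.Icc 1 l, IntegrableOn
      (fun z => (l.choose j : ℝ) * expansionIntegrand q r₀ γ α j z) (Ioi 0) := fun j hj =>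
    (integrableOn_expansionIntegrand hq₀ hq₁ hr₀ hγ hα (Finset.mem_Icc.1 hj).1).const_mul _
  have heq : ∫ z in Ioi (0 : ℝ), (-∑ j ∈ Finset.Icc 1 l,
      (l.choose j : ℝ) * expansionIntegrand q r₀ γ α j z) =
      -∑ j ∈ Finset.Icc 1 l, (l.choose j : ℝ) *
        ∫ z in Ioi (0 : ℝ), expansionIntegrand q r₀ γ α j z := by
    rw [integral_neg, integral_finsetSum _ hint]
    simp only [integral_const_mul]
  have hnn : ∀ z ∈ Ioi (0 : ℝ), 0 ≤ -∑ j ∈ Finset.Icc 1 l,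
      (l.choose j : ℝ) * expansionIntegrand q r₀ γ α j z := fun z hz => by
    have hz0 : 0 ≤ z := le_of_lt hz
    rw [← one_sub_factor_pow_mul hr₀ hγ l hz0]
    refine mul_nonneg (sub_nonneg.2 ?_) hz0
    exact pow_le_one₀ (factor_pos hq₀ hq₁ hr₀ hγ hz0).le (factor_le_one hq₀ hr₀ hγ hz0)
  have hnn' := (ae_restrict_iff' (μ := volume) measurableSet_Ioi).2 (ae_of_all _ hnn)
  have hI : IntegrableOn (fun z => -∑ j ∈ Finset.Icc 1 l,
      (l.choose j : ℝ) * expansionIntegrand q r₀ γ α j z) (Ioi 0) :=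
    (integrable_finsetSum _ hint).neg
  rw [← heq]
  refine ⟨?_, integral_nonneg_of_ae hnn'⟩
  rw [ofReal_integral_eq_lintegral_ofReal hI hnn', pgflIntegral]
  refine setLIntegral_congr_fun measurableSet_Ioi fun z hz => ?_
  rw [one_sub_factor_pow_mul hr₀ hγ l (le_of_lt hz)]

lemma lintegral_one_sub_expNeg_logLoss (hq₀ : 0 ≤ q) (hq₁ : q ≤ 1) (hr₀ : 0 < r₀) (hγ : 0 < γ)
    (lam : ℝ) (l : ℕ) :
    ∫⁻ x : Plane, (1 - expNeg (l * logLoss q r₀ γ α ‖x‖)) ∂(ENNReal.ofReal lam • volume) =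
      ENNReal.ofReal (2 * Real.pi * lam) * pgflIntegral q r₀ γ α l := by
  rw [lintegral_smul_measure, lintegral_norm_plane (g := fun z =>
    1 - expNeg (l * logLoss q r₀ γ α z)) (by fun_prop), smul_eq_mul, ← mul_assoc,
    mul_comm (ENNReal.ofReal lam), ← ENNReal.ofReal_mul (by positivity), pgflIntegral]
  congr 1
  refine setLIntegral_congr_fun measurableSet_Ioi fun z hz => ?_
  have hz0 : 0 ≤ z := le_of_lt hz
  have h0 := (factor_pos (α := α) hq₀ hq₁ hr₀ hγ hz0).le
  have h1 := pow_le_one₀ (n := l) h0 (factor_le_one hq₀ hr₀ hγ hz0)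
  rw [expNeg_nat_mul, expNeg_logLoss hq₀ hq₁ hr₀ hγ hz0, ← ENNReal.ofReal_pow h0,
    ← ENNReal.ofReal_one, ← ENNReal.ofReal_sub _ (by positivity), ← ENNReal.ofReal_mul hz0,
    mul_comm]

end Factor

/-! ### Independence and exponential laws -/

lemma iIndep_sumElim {Ω ι κ : Type*} {m₁ : ι → MeasurableSpace Ω} {m₂ : κ → MeasurableSpace Ω}
    {mΩ : MeasurableSpace Ω} {P : Measure Ω} (h₁ : iIndep m₁ P) (h₂ : iIndep m₂ P)
    (h : Indep (⨆ i, m₁ i) (⨆ j, m₂ j) P) : iIndep (Sum.elim m₁ m₂) P := by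
  rw [iIndep_iff]
  intro s f hf
  have hl : ∀ i ∈ s.toLeft, MeasurableSet[m₁ i] (f (Sum.inl i)) := fun i hi =>
    hf _ (Finset.mem_toLeft.1 hi)
  have hr : ∀ j ∈ s.toRight, MeasurableSet[m₂ j] (f (Sum.inr j)) := fun j hj =>
    hf _ (Finset.mem_toRight.1 hj)
  have hs : ⋂ i ∈ s, f i = (⋂ i ∈ s.toLeft, f (Sum.inl i)) ∩ ⋂ j ∈ s.toRight, f (Sum.inr j) := by
    ext ω
    simp
  conv_rhs => rw [← s.toLeft_disjSum_toRight, Finset.prod_disjSum]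
  rw [hs, ← h₁.meas_biInter hl, ← h₂.meas_biInter hr]
  refine (Indep_iff _ _ _).1 h _ _ ?_ ?_
  · exact s.toLeft.measurableSet_biInter fun i hi => le_iSup m₁ i _ (hl i hi)
  · exact s.toRight.measurableSet_biInter fun j hj => le_iSup m₂ j _ (hr j hj)

/-- Disintegration along independent random variables. -/
lemma measure_preimage_prodMk_of_indepFun {Ω 𝓧 𝓨 : Type*} [MeasurableSpace Ω] [MeasurableSpace 𝓧]
    [MeasurableSpace 𝓨] {P : Measure Ω} [IsProbabilityMeasure P] {X : Ω → 𝓧} {Y : Ω → 𝓨}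
    (hX : Measurable X) (hY : Measurable Y) (h : IndepFun X Y P) {B : Set (𝓧 × 𝓨)}
    (hB : MeasurableSet B) :
    P {ω | (X ω, Y ω) ∈ B} = ∫⁻ ω, P {ω' | (X ω, Y ω') ∈ B} ∂P := by
  have h1 : P {ω | (X ω, Y ω) ∈ B} = P.map (fun ω => (X ω, Y ω)) B :=
    (Measure.map_apply (hX.prodMk hY) hB).symm
  rw [h1, (indepFun_iff_map_prod_eq_prod_map_map hX.aemeasurable hY.aemeasurable).1 h,
    Measure.prod_apply hB, lintegral_map (measurable_measure_prodMk_left hB) hX]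
  refine lintegral_congr fun ω => ?_
  rw [Measure.map_apply hY (measurable_prodMk_left hB)]
  rfl

/-- The Laplace transform of the exponential distribution of mean one. -/
lemma lintegral_expNeg_expMeasure {a : ℝ} (ha : 0 ≤ a) :
    ∫⁻ y, expNeg (ENNReal.ofReal (a * y)) ∂(expMeasure 1) = ENNReal.ofReal (1 / (1 + a)) := by
  have h1a : 0 < 1 + a := by linarith
  have hd : expMeasure 1 = volume.withDensity (exponentialPDF 1) := rfl
  have hm : Measurable (exponentialPDF 1) := (measurable_exponentialPDFReal 1).ennreal_ofReal
  have hm' : Measurable (exponentialPDF (1 + a)) :=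
    (measurable_exponentialPDFReal (1 + a)).ennreal_ofReal
  rw [hd, lintegral_withDensity_eq_lintegral_mul _ hm (by fun_prop), ← mul_one
    (ENNReal.ofReal (1 / (1 + a))), ← lintegral_exponentialPDF_eq_one h1a,
    ← lintegral_const_mul _ hm']
  refine lintegral_congr fun y => ?_
  rw [Pi.mul_apply]
  rcases lt_or_ge y 0 with hy | hy
  · rw [exponentialPDF_of_neg hy, exponentialPDF_of_neg hy, zero_mul, mul_zero]
  · rw [exponentialPDF_of_nonneg hy, exponentialPDF_of_nonneg hy, expNeg_ofReal (by positivity),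
      ← ENNReal.ofReal_mul (by positivity), ← ENNReal.ofReal_mul (by positivity)]
    congr 1
    rw [one_mul, one_mul, ← Real.exp_add, ← mul_assoc, one_div_mul_cancel h1a.ne', one_mul]
    ring_nf

lemma expMeasure_lt_ofReal (u : ℝ≥0∞) : expMeasure 1 {v | u < ENNReal.ofReal v} = expNeg u := by
  have := isProbabilityMeasure_expMeasure one_pos
  obtain rfl | hu := eq_or_ne u ∞
  · simp
  · have hset : {v | u < ENNReal.ofReal v} = (Iic u.toReal)ᶜ := by
      ext v
      simp [ENNReal.lt_ofReal_iff_toReal_lt hu]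
    have hc := cdf_expMeasure_eq one_pos u.toReal
    rw [if_pos ENNReal.toReal_nonneg, cdf_eq_real, one_mul] at hc
    rw [hset, ← ENNReal.ofReal_toReal (measure_ne_top _ _), ← measureReal_def,
      probReal_compl_eq_one_sub measurableSet_Iic, hc, sub_sub_cancel,
      ← expNeg_ofReal ENNReal.toReal_nonneg, ENNReal.ofReal_toReal hu]

/-- Conditioning on `U` leaves the exponential tail `e^{-U}`. This is how Rayleigh fading turns a
success probability into a Laplace transform. -/
lemma measure_lt_ofReal_of_hasLaw_expMeasure {Ω : Type*} [MeasurableSpace Ω] {P : Measure Ω}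
    [IsProbabilityMeasure P] {U : Ω → ℝ≥0∞} {V : Ω → ℝ} (hU : Measurable U) (hV : Measurable V)
    (hlaw : HasLaw V (expMeasure 1) P) (h : IndepFun U V P) :
    P {ω | U ω < ENNReal.ofReal (V ω)} = ∫⁻ ω, expNeg (U ω) ∂P := by
  have hB : MeasurableSet {p : ℝ≥0∞ × ℝ | p.1 < ENNReal.ofReal p.2} :=
    measurableSet_lt measurable_fst measurable_snd.ennreal_ofReal
  have h1 := measure_preimage_prodMk_of_indepFun hU hV h hB
  refine h1.trans (lintegral_congr fun ω => ?_)
  rw [← expMeasure_lt_ofReal, ← hlaw.map_eq, Measure.map_apply hV]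
  · rfl
  · exact measurableSet_lt measurable_const ENNReal.measurable_ofReal

/-- The Laplace transform of a series of successively independent random variables. -/
lemma lintegral_expNeg_tsum {Ω : Type*} [mΩ : MeasurableSpace Ω] {P : Measure Ω}
    [IsProbabilityMeasure P] {Y : ℕ → Ω → ℝ≥0∞} {b : ℕ → ℝ≥0∞} {F H : ℕ → MeasurableSpace Ω}
    (hF : Monotone F) (hFle : ∀ n, F n ≤ mΩ) (hH : ∀ n, H n ≤ F (n + 1))
    (hY : ∀ n, Measurable[H n] (Y n)) (hind : ∀ n, Indep (F n) (H n) P)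
    (hb : ∀ n, ∫⁻ ω, expNeg (Y n ω) ∂P = expNeg (b n)) :
    ∫⁻ ω, expNeg (∑' n, Y n ω) ∂P = expNeg (∑' n, b n) := by
  have hYF : ∀ i n, i < n → Measurable[F n] (Y i) := fun i n hin =>
    (hY i).mono ((hH i).trans (hF hin)) le_rfl
  have hYm : ∀ i, Measurable (Y i) := fun i => (hYF i (i + 1) (by omega)).mono (hFle _) le_rfl
  have hfin : ∀ n, ∫⁻ ω, expNeg (∑ i ∈ Finset.range n, Y i ω) ∂P =
      expNeg (∑ i ∈ Finset.range n, b i) := fun n => by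
    induction n with
    | zero => simp
    | succ n ih =>
      have hs : Measurable[F n] fun ω => expNeg (∑ i ∈ Finset.range n, Y i ω) :=
        measurable_expNeg.comp (Finset.measurable_fun_sum (m := F n) _ fun i hi =>
          hYF i n (Finset.mem_range.1 hi))
      have ht : Measurable[H n] fun ω => expNeg (Y n ω) := measurable_expNeg.comp (hY n)
      simp only [Finset.sum_range_succ, expNeg_add]
      rw [lintegral_mul_eq_lintegral_mul_lintegral_of_independent_measurableSpace (hFle n)
        ((hH n).trans (hFle _)) (hind n) hs ht, ih, hb n]
  have hl : Tendsto (fun n => ∫⁻ ω, expNeg (∑ i ∈ Finset.range n, Y i ω) ∂P) atTop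
      (𝓝 (∫⁻ ω, expNeg (∑' n, Y n ω) ∂P)) := by
    refine tendsto_lintegral_of_dominated_convergence (fun _ => 1)
      (fun n => measurable_expNeg.comp (Finset.measurable_fun_sum _ fun i _ => hYm i))
      (fun n => ae_of_all _ fun ω => expNeg_le_one _) (by simp) (ae_of_all _ fun ω => ?_)
    exact (continuous_expNeg.tendsto _).comp ENNReal.summable.hasSum.tendsto_sum_nat
  have hr : Tendsto (fun n => expNeg (∑ i ∈ Finset.range n, b i)) atTop
      (𝓝 (expNeg (∑' n, b n))) :=
    (continuous_expNeg.tendsto _).comp ENNReal.summable.hasSum.tendsto_sum_nat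
  exact tendsto_nhds_unique hl (by simpa only [hfin] using hr)

/-! ### Frozen and canonical networks, measurability, success events -/

namespace Network

variable {Ω : Type*}

/-- The network with the controllers placed at the deterministic locations `x`. -/
def freeze (N : Network Ω) (x : ℕ → Plane) : Network Ω where
  X i _ := x i
  h := N.h
  C := N.C

/-- The network on the space of all locations, fading coefficients and access states. -/
def canonical : Network ((ℕ → Plane) × ((ℕ × ℕ → ℂ) × (ℕ × ℕ → Fin 2))) where
  X i p := p.1 i
  h i t p := p.2.1 (i, t)
  C i t p := p.2.2 (i, t)

/-- All fading coefficients and access states. -/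
def links (N : Network Ω) (ω : Ω) : (ℕ × ℕ → ℂ) × (ℕ × ℕ → Fin 2) :=
  ((fun p => N.h p.1 p.2 ω), (fun p => N.C p.1 p.2 ω))

/-- The point process of a sequence of locations, the typical one excluded. -/
noncomputable def pointMeasure (x : ℕ → Plane) : Measure Plane :=
  Measure.sum fun i : ℕ => Measure.dirac (x (i + 1))

lemma measurable_pointMeasure : Measurable pointMeasure := by
  refine Measure.measurable_of_measurable_coe _ fun s hs => ?_
  simp only [pointMeasure, Measure.sum_apply _ hs]
  exact Measurable.tsum fun i =>
    (Measure.measurable_coe hs).comp (Measure.measurable_dirac.comp (measurable_pi_apply _))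

lemma lintegral_pointMeasure (x : ℕ → Plane) {f : Plane → ℝ≥0∞} (hf : Measurable f) :
    ∫⁻ y, f y ∂(pointMeasure x) = ∑' i, f (x (i + 1)) := by
  simp only [pointMeasure, lintegral_sum_measure, lintegral_dirac' _ hf]

section Measurability

variable (N : Network Ω) (η ρ α N₀ γ : ℝ) {t : ℕ}

lemma measurable_power {m : MeasurableSpace Ω} {i : ℕ} (hX : Measurable (N.X i))
    (hh : Measurable (N.h i t)) : Measurable (N.power η ρ α i t) := by
  unfold power r; fun_prop

lemma measurable_access {m : MeasurableSpace Ω} {i : ℕ} (hC : Measurable (N.C i t)) :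
    Measurable fun ω => ((N.C i t ω : ℕ) : ℝ≥0∞) :=
  (measurable_from_top (f := fun c : Fin 2 => ((c : ℕ) : ℝ≥0∞))).comp hC

lemma measurable_interference {m : MeasurableSpace Ω} (hX : ∀ i, Measurable (N.X (i + 1)))
    (hh : ∀ i, Measurable (N.h (i + 1) t)) (hC : ∀ i, Measurable (N.C (i + 1) t)) :
    Measurable (N.interference η ρ α t) :=
  Measurable.tsum fun i => (N.measurable_access (hC i)).mul
    (N.measurable_power η ρ α (hX i) (hh i)).ennreal_ofReal

lemma measurable_sinr {m : MeasurableSpace Ω} (hX : ∀ i, Measurable (N.X i))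
    (hh : ∀ i, Measurable (N.h i t)) (hC : ∀ i, Measurable (N.C (i + 1) t)) :
    Measurable (N.sinr η ρ α N₀ t) :=
  (N.measurable_power η ρ α (hX 0) (hh 0)).ennreal_ofReal.div (measurable_const.add
    (N.measurable_interference η ρ α (fun i => hX (i + 1)) (fun i => hh (i + 1)) hC))

end Measurability

/-- The event that a transmission of the typical controller at time `t` is decodable. -/
def goodEvent (N : Network Ω) (η ρ α N₀ γ : ℝ) (t : ℕ) : Set Ω :=
  {ω | ENNReal.ofReal γ < N.sinr η ρ α N₀ t ω}

/-- The event that the typical controller transmits successfully at time `t`. -/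
def successEvent (N : Network Ω) (η ρ α N₀ γ : ℝ) (t : ℕ) : Set Ω :=
  {ω | N.C 0 t ω = 1} ∩ N.goodEvent η ρ α N₀ γ t

lemma S_eq_one_iff (N : Network Ω) (η ρ α N₀ γ : ℝ) (t : ℕ) (ω : Ω) :
    N.S η ρ α N₀ γ t ω = 1 ↔ ω ∈ N.successEvent η ρ α N₀ γ t := by
  have hC : N.C 0 t ω = 0 ∨ N.C 0 t ω = 1 := by
    generalize N.C 0 t ω = c
    fin_cases c <;> simp
  rcases hC with hC | hC <;> simp [S, successEvent, goodEvent, hC]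

lemma setOf_blockControllable (N : Network Ω) (η ρ α N₀ γ : ℝ) {n : ℕ}
    (A : Matrix (Fin n) (Fin n) ℝ) (T k : ℕ) :
    {ω | BlockControllable A T k (fun τ => N.S η ρ α N₀ γ τ ω)} =
      runEvent (fun j => N.successEvent η ρ α N₀ γ (k * T + j)) (minpoly ℝ A).natDegree T := by
  ext ω
  simp only [BlockControllable, runEvent, mem_ofPred_eq, S_eq_one_iff, add_assoc]

/-! ### Independence of disjoint families of links -/

/-- The sigma-algebras generated by the single fading coefficients and access states. -/
@[reducible] noncomputable def linkAlgebra (N : Network Ω) :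
    (ℕ × ℕ) ⊕ (ℕ × ℕ) → MeasurableSpace Ω :=
  Sum.elim (fun p => MeasurableSpace.comap (N.h p.1 p.2) inferInstance)
    (fun p => MeasurableSpace.comap (N.C p.1 p.2) inferInstance)

/-- The sigma-algebra generated by the fading coefficients and access states in an index set. -/
@[reducible] noncomputable def linkSup (N : Network Ω)
    (s : Set ((ℕ × ℕ) ⊕ (ℕ × ℕ))) : MeasurableSpace Ω :=
  ⨆ i ∈ s, N.linkAlgebra i

lemma linkSup_mono (N : Network Ω) {s s' : Set ((ℕ × ℕ) ⊕ (ℕ × ℕ))} (h : s ⊆ s') :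
    N.linkSup s ≤ N.linkSup s' := biSup_mono fun _ hi => h hi

lemma measurable_h_linkSup (N : Network Ω) {s : Set ((ℕ × ℕ) ⊕ (ℕ × ℕ))} {i t : ℕ}
    (h : Sum.inl (i, t) ∈ s) : Measurable[N.linkSup s] (N.h i t) :=
  (comap_measurable (N.h i t)).mono (le_biSup N.linkAlgebra h) le_rfl

lemma measurable_C_linkSup (N : Network Ω) {s : Set ((ℕ × ℕ) ⊕ (ℕ × ℕ))} {i t : ℕ}
    (h : Sum.inr (i, t) ∈ s) : Measurable[N.linkSup s] (N.C i t) :=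
  (comap_measurable (N.C i t)).mono (le_biSup N.linkAlgebra h) le_rfl

/-- The indices of links of controllers with indices `1, …, n`. -/
def interfererIndices (n : ℕ) : Set ((ℕ × ℕ) ⊕ (ℕ × ℕ)) :=
  {i | i.elim Prod.fst Prod.fst ∈ Ioc 0 n}

/-- The indices of links in slot `t`. -/
def slotIndices (t : ℕ) : Set ((ℕ × ℕ) ⊕ (ℕ × ℕ)) :=
  {i | i.elim Prod.snd Prod.snd = t}

/-- The indices of links in slots before `t`. -/
def pastIndices (t : ℕ) : Set ((ℕ × ℕ) ⊕ (ℕ × ℕ)) :=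
  {i | i.elim Prod.snd Prod.snd < t}

namespace IsClassicalAloha

variable [mΩ : MeasurableSpace Ω] {P : Measure Ω} {lam q r₀ : ℝ}
  {N : Network Ω} (hN : N.IsClassicalAloha P lam q r₀)

include hN

lemma linkAlgebra_le (i : (ℕ × ℕ) ⊕ (ℕ × ℕ)) : N.linkAlgebra i ≤ mΩ := by
  rcases i with p | p
  · exact (hN.measurable_h p.1 p.2).comap_le
  · exact (hN.measurable_C p.1 p.2).comap_le

lemma linkSup_le (s : Set ((ℕ × ℕ) ⊕ (ℕ × ℕ))) : N.linkSup s ≤ mΩ :=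
  iSup₂_le fun i _ => hN.linkAlgebra_le i

lemma iIndep_linkAlgebra : iIndep N.linkAlgebra P := by
  refine iIndep_sumElim hN.indep_fading hN.indep_access ?_
  refine indep_of_indep_of_le ((IndepFun_iff_Indep _ _ _).1 hN.indep_fading_access)
    (iSup_le fun p => ?_) (iSup_le fun p => ?_)
  · have h : Measurable fun f : ℕ × ℕ → ℂ => f p := measurable_pi_apply p
    exact (h.comp (comap_measurable fun ω (p : ℕ × ℕ) => N.h p.1 p.2 ω)).comap_le
  · have h : Measurable fun f : ℕ × ℕ → Fin 2 => f p := measurable_pi_apply p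
    exact (h.comp (comap_measurable fun ω (p : ℕ × ℕ) => N.C p.1 p.2 ω)).comap_le

lemma indep_linkSup {s s' : Set ((ℕ × ℕ) ⊕ (ℕ × ℕ))} (h : Disjoint s s') :
    Indep (N.linkSup s) (N.linkSup s') P :=
  indep_iSup_of_disjoint hN.linkAlgebra_le hN.iIndep_linkAlgebra h

end IsClassicalAloha

/-! ### Success probabilities at frozen locations -/

namespace IsClassicalAloha

variable [mΩ : MeasurableSpace Ω] {P : Measure Ω}
  {lam q r₀ η ρ α N₀ γ : ℝ} {N : Network Ω} (hN : N.IsClassicalAloha P lam q r₀)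

include hN

/-- Split by the access state: a silent controller contributes `1`, a transmitting one the
exponential transform `1 / (1 + a)`. -/
lemma lintegral_expNeg_access_mul [IsProbabilityMeasure P] (hq₀ : 0 ≤ q) (hq₁ : q ≤ 1)
    (i t : ℕ) {a : ℝ} (ha : 0 ≤ a) :
    ∫⁻ ω, expNeg (((N.C i t ω : ℕ) : ℝ≥0∞) * ENNReal.ofReal (a * ‖N.h i t ω‖ ^ 2)) ∂P =
      ENNReal.ofReal (q * (1 / (1 + a)) + 1 - q) := by
  have hh := hN.measurable_h i t
  have hE : MeasurableSet[N.linkSup {Sum.inr (i, t)}] {ω | N.C i t ω = 1} :=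
    N.measurable_C_linkSup (mem_singleton _) (measurableSet_singleton 1)
  have hE' : MeasurableSet {ω | N.C i t ω = 1} := hN.linkSup_le _ _ hE
  have hX : Measurable[N.linkSup {Sum.inl (i, t)}] fun ω =>
      expNeg (ENNReal.ofReal (a * ‖N.h i t ω‖ ^ 2)) := by
    have hg : Measurable fun w : ℂ => expNeg (ENNReal.ofReal (a * ‖w‖ ^ 2)) := by fun_prop
    exact hg.comp (N.measurable_h_linkSup (mem_singleton _))
  have hlap : ∫⁻ ω, expNeg (ENNReal.ofReal (a * ‖N.h i t ω‖ ^ 2)) ∂P =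
      ENNReal.ofReal (1 / (1 + a)) := by
    rw [← lintegral_expNeg_expMeasure ha, ← (hN.fading_law i t).map_eq,
      lintegral_map (by fun_prop) (by fun_prop)]
  have hsplit : ∀ ω, expNeg (((N.C i t ω : ℕ) : ℝ≥0∞) * ENNReal.ofReal (a * ‖N.h i t ω‖ ^ 2)) =
      {ω | N.C i t ω = 1}.indicator 1 ω * expNeg (ENNReal.ofReal (a * ‖N.h i t ω‖ ^ 2)) +
        {ω | N.C i t ω = 1}ᶜ.indicator 1 ω := fun ω => by
    have hC : N.C i t ω = 0 ∨ N.C i t ω = 1 := by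
      generalize N.C i t ω = c
      fin_cases c <;> simp
    rcases hC with hC | hC <;> simp [hC]
  have h1 : Measurable[N.linkSup {Sum.inr (i, t)}] (1 : Ω → ℝ≥0∞) :=
    @measurable_const _ _ _ (N.linkSup {Sum.inr (i, t)}) 1
  have hI : Measurable[N.linkSup {Sum.inr (i, t)}]
      ({ω | N.C i t ω = 1}.indicator (1 : Ω → ℝ≥0∞)) := h1.indicator hE
  have hprod := lintegral_mul_eq_lintegral_mul_lintegral_of_independent_measurableSpace
    (hN.linkSup_le _) (hN.linkSup_le _)
    (hN.indep_linkSup (s := {Sum.inr (i, t)}) (s' := {Sum.inl (i, t)}) (by simp))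
    hI hX
  rw [lintegral_congr hsplit, lintegral_add_right _ (measurable_one.indicator hE'.compl), hprod,
    lintegral_indicator_one hE', lintegral_indicator_one hE'.compl, hlap, prob_compl_eq_one_sub hE',
    hN.access_law, ← ENNReal.ofReal_mul hq₀, ← ENNReal.ofReal_one, ← ENNReal.ofReal_sub _ hq₀,
    ← ENNReal.ofReal_add (by positivity) (by linarith), add_sub_assoc]

lemma lintegral_expNeg_interference [IsProbabilityMeasure P]
    (hq₀ : 0 ≤ q) (hq₁ : q ≤ 1) (hr₀ : 0 < r₀) (hη : 0 < η)
    (hρ : 0 < ρ) (hγ : 0 < γ) (x : ℕ → Plane) (t : ℕ) :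
    ∫⁻ ω, expNeg (ENNReal.ofReal (γ / (η * ρ * r₀ ^ (-α))) *
      (N.freeze x).interference η ρ α t ω) ∂P =
    expNeg (∑' i, logLoss q r₀ γ α ‖x (i + 1)‖) := by
  -- The received power relative to the typical link, times `γ`; with it `1 / (1 + a i)` is the
  -- fraction inside `factor`.
  set a : ℕ → ℝ := fun i => γ * ‖x (i + 1)‖ ^ (-α) / r₀ ^ (-α) with ha
  have ha0 : ∀ i, 0 ≤ a i := fun i => by positivity
  have hterm : ∀ ω, ENNReal.ofReal (γ / (η * ρ * r₀ ^ (-α))) *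
      (N.freeze x).interference η ρ α t ω =
      ∑' i, ((N.C (i + 1) t ω : ℕ) : ℝ≥0∞) * ENNReal.ofReal (a i * ‖N.h (i + 1) t ω‖ ^ 2) :=
    fun ω => by
      rw [interference, ← ENNReal.tsum_mul_left]
      refine tsum_congr fun i => ?_
      rw [mul_left_comm, ← ENNReal.ofReal_mul (by positivity)]
      congr 2
      have := (Real.rpow_pos_of_pos hr₀ (-α)).ne'
      simp only [power, r, freeze, ha]
      field_simp
  simp only [hterm]
  refine lintegral_expNeg_tsum (F := fun n => N.linkSup (interfererIndices n))
    (H := fun n => N.linkSup {Sum.inl (n + 1, t), Sum.inr (n + 1, t)})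
    (fun m n hmn => N.linkSup_mono fun i hi => ⟨hi.1, hi.2.trans hmn⟩)
    (fun n => hN.linkSup_le _) (fun n => N.linkSup_mono ?_) (fun n => ?_)
    (fun n => hN.indep_linkSup ?_) (fun n => ?_)
  · rintro i (rfl | rfl) <;> simp [interfererIndices]
  · have hg : Measurable fun w : ℂ => ENNReal.ofReal (a n * ‖w‖ ^ 2) := by fun_prop
    exact (N.measurable_access (N.measurable_C_linkSup (by simp))).mul
      (hg.comp (N.measurable_h_linkSup (by simp)))
  · simp [interfererIndices]
  · rw [hN.lintegral_expNeg_access_mul hq₀ hq₁ _ _ (ha0 n),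
      expNeg_logLoss hq₀ hq₁ hr₀ hγ (norm_nonneg _), factor, ha]
    have := (Real.rpow_pos_of_pos hr₀ (-α)).ne'
    congr 4
    field_simp

lemma measure_goodEvent_freeze [IsProbabilityMeasure P]
    (hq₀ : 0 ≤ q) (hq₁ : q ≤ 1) (hr₀ : 0 < r₀) (hη : 0 < η)
    (hρ : 0 < ρ) (hγ : 0 < γ) {x : ℕ → Plane} (hx : ‖x 0‖ = r₀) (t : ℕ) :
    P ((N.freeze x).goodEvent η ρ α N₀ γ t) =
      expNeg (ENNReal.ofReal (γ * N₀ / (η * ρ * r₀ ^ (-α))) +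
        ∑' i, logLoss q r₀ γ α ‖x (i + 1)‖) := by
  have hc : 0 < η * ρ * r₀ ^ (-α) := by positivity
  set c := η * ρ * r₀ ^ (-α) with hcdef
  let U : Ω → ℝ≥0∞ := fun ω => ENNReal.ofReal (γ / c) *
    (ENNReal.ofReal N₀ + (N.freeze x).interference η ρ α t ω)
  -- Dividing by the mean power `c` of the typical link isolates `|h₀|²`; infinite interference
  -- makes both sides false.
  have hset : (N.freeze x).goodEvent η ρ α N₀ γ t =
      {ω | U ω < ENNReal.ofReal (‖N.h 0 t ω‖ ^ 2)} := by
    ext ω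
    have hp : (N.freeze x).power η ρ α 0 t ω = c * ‖N.h 0 t ω‖ ^ 2 := by
      simp only [power, r, freeze, hx, hcdef]
      ring
    have hγc : ENNReal.ofReal γ = ENNReal.ofReal c * ENNReal.ofReal (γ / c) := by
      rw [← ENNReal.ofReal_mul hc.le, mul_div_cancel₀ _ hc.ne']
    simp only [goodEvent, mem_ofPred_eq, sinr, U]
    rw [ENNReal.lt_div_iff_mul_lt (Or.inr (by simp)) (Or.inr (by simpa using hγ)), hp, hγc,
      ENNReal.ofReal_mul hc.le, mul_assoc,
      ENNReal.mul_lt_mul_iff_right (by simpa using hc) (by simp)]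
  let s : Set ((ℕ × ℕ) ⊕ (ℕ × ℕ)) := {i | 0 < i.elim Prod.fst Prod.fst}
  have hU : Measurable[N.linkSup s] U :=
    Measurable.const_mul (Measurable.const_add ((N.freeze x).measurable_interference η ρ α
      (fun i => measurable_const) (fun i => N.measurable_h_linkSup (by simp [s]))
      (fun i => N.measurable_C_linkSup (by simp [s]))) _) _
  have hV : Measurable[N.linkSup {Sum.inl (0, t)}] fun ω => ‖N.h 0 t ω‖ ^ 2 := by
    have hg : Measurable fun w : ℂ => ‖w‖ ^ 2 := by fun_prop
    exact hg.comp (N.measurable_h_linkSup (mem_singleton _))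
  have hind : IndepFun U (fun ω => ‖N.h 0 t ω‖ ^ 2) P :=
    (IndepFun_iff_Indep _ _ _).2 (indep_of_indep_of_le
      (hN.indep_linkSup (s := s) (s' := {Sum.inl (0, t)}) (by simp [s])) hU.comap_le hV.comap_le)
  have hI : Measurable fun ω => expNeg (ENNReal.ofReal (γ / c) *
      (N.freeze x).interference η ρ α t ω) :=
    measurable_expNeg.comp (((N.freeze x).measurable_interference η ρ α
      (fun i => measurable_const) (fun i => hN.measurable_h _ _)
      (fun i => hN.measurable_C _ _)).const_mul _)
  rw [hset, measure_lt_ofReal_of_hasLaw_expMeasure (hU.mono (hN.linkSup_le _) le_rfl)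
    (hV.mono (hN.linkSup_le _) le_rfl) (hN.fading_law 0 t) hind]
  simp only [U, mul_add, expNeg_add]
  rw [lintegral_const_mul _ hI, hN.lintegral_expNeg_interference hq₀ hq₁ hr₀ hη hρ hγ,
    ← ENNReal.ofReal_mul (by positivity), div_mul_eq_mul_div]

/-- The past, the current slot without `C 0 t`, and `C 0 t` itself use disjoint sets of links, since
the SINR does not involve the access state of the typical controller. -/
lemma measureReal_inter_successEvent_freeze (hq₀ : 0 ≤ q) (x : ℕ → Plane) {t : ℕ} {A : Set Ω}
    (hA : MeasurableSet[N.linkSup (pastIndices t)] A) :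
    P.real (A ∩ (N.freeze x).successEvent η ρ α N₀ γ t) =
      P.real A * (q * P.real ((N.freeze x).goodEvent η ρ α N₀ γ t)) := by
  let s : Set ((ℕ × ℕ) ⊕ (ℕ × ℕ)) := slotIndices t \ {Sum.inr (0, t)}
  have hG : MeasurableSet[N.linkSup s] ((N.freeze x).goodEvent η ρ α N₀ γ t) :=
    measurableSet_lt measurable_const ((N.freeze x).measurable_sinr η ρ α N₀
      (fun i => measurable_const)
      (fun i => N.measurable_h_linkSup (by simp [s, slotIndices]))
      (fun i => N.measurable_C_linkSup (by simp [s, slotIndices])))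
  have hC : MeasurableSet[N.linkSup {Sum.inr (0, t)}] {ω | N.C 0 t ω = 1} :=
    N.measurable_C_linkSup (mem_singleton _) (measurableSet_singleton 1)
  have hAG : MeasurableSet[N.linkSup {Sum.inr (0, t)}ᶜ]
      (A ∩ (N.freeze x).goodEvent η ρ α N₀ γ t) := by
    refine (N.linkSup_mono ?_ _ hA).inter (N.linkSup_mono ?_ _ hG)
    · rintro i hi rfl
      simp [pastIndices] at hi
    · exact fun i hi => hi.2
  have hdisj : Disjoint (pastIndices t) s := by
    refine Set.disjoint_left.2 fun i hi hi' => ?_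
    have h1 : i.elim Prod.snd Prod.snd < t := hi
    have h2 : i.elim Prod.snd Prod.snd = t := hi'.1
    omega
  have h1 := (Indep_iff _ _ _).1 (hN.indep_linkSup
    (s := {Sum.inr (0, t)}ᶜ) (s' := {Sum.inr (0, t)}) disjoint_compl_left) _ _ hAG hC
  have h2 := (Indep_iff _ _ _).1 (hN.indep_linkSup hdisj) _ _ hA hG
  have hset : A ∩ (N.freeze x).successEvent η ρ α N₀ γ t =
      A ∩ (N.freeze x).goodEvent η ρ α N₀ γ t ∩ {ω | N.C 0 t ω = 1} := by
    rw [successEvent, inter_comm _ ((N.freeze x).goodEvent η ρ α N₀ γ t), ← inter_assoc]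
    rfl
  rw [measureReal_def, hset, h1, h2, hN.access_law, ENNReal.toReal_mul, ENNReal.toReal_mul,
    ENNReal.toReal_ofReal hq₀, measureReal_def, measureReal_def]
  ring

lemma measureReal_runEvent_freeze [IsProbabilityMeasure P]
    (hq₀ : 0 ≤ q) (x : ℕ → Plane) {p : ℝ} {b : ℕ}
    (hp : ∀ t, P.real ((N.freeze x).goodEvent η ρ α N₀ γ t) = p) (v T : ℕ) :
    P.real (runEvent (fun j => (N.freeze x).successEvent η ρ α N₀ γ (b + j)) v T) =
      deMoivreSum (fun n => (q * p) ^ n) T v := by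
  refine measureReal_runEvent (F := fun k => N.linkSup (pastIndices (b + k)))
    (fun m n hmn => N.linkSup_mono fun i hi => lt_of_lt_of_le (b := b + m) hi (by omega))
    (fun k => hN.linkSup_le _) (fun k => ?_) (fun k A hA => ?_) v T
  · refine MeasurableSet.inter ?_ ?_
    · exact N.measurable_C_linkSup (s := pastIndices (b + (k + 1))) (by simp [pastIndices])
        (measurableSet_singleton 1)
    · exact measurableSet_lt measurable_const ((N.freeze x).measurable_sinr η ρ α N₀
        (fun i => measurable_const)
        (fun i => N.measurable_h_linkSup (by simp [pastIndices]))
        (fun i => N.measurable_C_linkSup (by simp [pastIndices])))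
  · rw [hN.measureReal_inter_successEvent_freeze hq₀ x hA, hp]

end IsClassicalAloha

/-! ### Averaging over the locations -/

/-- The success probability given the point process, in exponential form. -/
noncomputable def successProb (N : Network Ω) (η ρ α N₀ γ q r₀ : ℝ) (ω : Ω) : ℝ≥0∞ :=
  expNeg (ENNReal.ofReal (γ * N₀ / (η * ρ * r₀ ^ (-α))) +
    ∫⁻ y, logLoss q r₀ γ α ‖y‖ ∂(N.Φ ω))

lemma successProb_eq (N : Network Ω) (η ρ α N₀ γ q r₀ : ℝ) (ω : Ω) :
    N.successProb η ρ α N₀ γ q r₀ ω = expNeg (ENNReal.ofReal (γ * N₀ / (η * ρ * r₀ ^ (-α))) +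
      ∑' i, logLoss q r₀ γ α ‖N.X (i + 1) ω‖) := by
  rw [successProb, ← lintegral_pointMeasure (fun i => N.X i ω)
    (f := fun y => logLoss q r₀ γ α ‖y‖) (by fun_prop)]
  rfl

lemma measurable_successProb_sigmaΦ (N : Network Ω) (η ρ α N₀ γ q r₀ : ℝ) :
    Measurable[N.sigmaΦ] (N.successProb η ρ α N₀ γ q r₀) := by
  have h : Measurable fun μ : Measure Plane =>
      expNeg (ENNReal.ofReal (γ * N₀ / (η * ρ * r₀ ^ (-α))) +
        ∫⁻ y, logLoss q r₀ γ α ‖y‖ ∂μ) :=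
    measurable_expNeg.comp
      (measurable_const.add (Measure.measurable_lintegral (by fun_prop)))
  exact h.comp (comap_measurable N.Φ)

lemma measurableSet_goodEvent_canonical (η ρ α N₀ γ : ℝ) (t : ℕ) :
    MeasurableSet (canonical.goodEvent η ρ α N₀ γ t) :=
  measurableSet_lt measurable_const (canonical.measurable_sinr η ρ α N₀
    (fun i => (measurable_pi_apply i).comp measurable_fst)
    (fun i => (measurable_pi_apply (i, t)).comp (measurable_fst.comp measurable_snd))
    (fun i => (measurable_pi_apply (i + 1, t)).comp (measurable_snd.comp measurable_snd)))

lemma measurableSet_successEvent_canonical (η ρ α N₀ γ : ℝ) (t : ℕ) :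
    MeasurableSet (canonical.successEvent η ρ α N₀ γ t) := by
  have h : Measurable (canonical.C 0 t) :=
    (measurable_pi_apply (0, t)).comp (measurable_snd.comp measurable_snd)
  exact (h (measurableSet_singleton 1)).inter (measurableSet_goodEvent_canonical η ρ α N₀ γ t)

namespace IsClassicalAloha

variable [mΩ : MeasurableSpace Ω] {P : Measure Ω} {lam q r₀ η ρ α N₀ γ : ℝ}
  {N : Network Ω} (hN : N.IsClassicalAloha P lam q r₀)

include hN

lemma sigmaΦ_le : N.sigmaΦ ≤ mΩ := hN.poisson.measurable.comap_le

lemma measurable_successProb : Measurable (N.successProb η ρ α N₀ γ q r₀) :=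
  (N.measurable_successProb_sigmaΦ η ρ α N₀ γ q r₀).mono hN.sigmaΦ_le le_rfl

lemma measurable_links : Measurable N.links :=
  (measurable_pi_lambda _ fun p : ℕ × ℕ => hN.measurable_h p.1 p.2).prodMk
    (measurable_pi_lambda _ fun p : ℕ × ℕ => hN.measurable_C p.1 p.2)

lemma measurableSet_goodEvent (t : ℕ) : MeasurableSet (N.goodEvent η ρ α N₀ γ t) :=
  measurableSet_lt measurable_const (N.measurable_sinr η ρ α N₀ hN.measurable_X
    (fun i => hN.measurable_h i t) (fun i => hN.measurable_C (i + 1) t))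

variable [IsProbabilityMeasure P]

lemma measure_preimage_links {B : Set ((ℕ → Plane) × ((ℕ × ℕ → ℂ) × (ℕ × ℕ → Fin 2)))}
    (hB : MeasurableSet B) :
    P {ω | ((fun i => N.X i ω), N.links ω) ∈ B} =
      ∫⁻ ω, P {ω' | ((fun i => N.X i ω), N.links ω') ∈ B} ∂P :=
  measure_preimage_prodMk_of_indepFun (measurable_pi_lambda _ hN.measurable_X) hN.measurable_links
    hN.indep_locations hB

lemma measure_goodEvent_freeze_eq (hq₀ : 0 ≤ q) (hq₁ : q ≤ 1) (hr₀ : 0 < r₀) (hη : 0 < η)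
    (hρ : 0 < ρ) (hγ : 0 < γ) (t : ℕ) (ω : Ω) :
    P ((N.freeze fun i => N.X i ω).goodEvent η ρ α N₀ γ t) =
      N.successProb η ρ α N₀ γ q r₀ ω := by
  rw [hN.measure_goodEvent_freeze (x := fun i => N.X i ω) hq₀ hq₁ hr₀ hη hρ hγ (hN.typical ω),
    successProb_eq]

/-- The characterizing identity of the conditional expectation given `Φ`. An event of `sigmaΦ` is
decided by the locations, so after disintegration it only switches the frozen probability on or off.
-/
lemma measure_inter_goodEvent (hq₀ : 0 ≤ q) (hq₁ : q ≤ 1) (hr₀ : 0 < r₀) (hη : 0 < η)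
    (hρ : 0 < ρ) (hγ : 0 < γ) (t : ℕ) {A : Set Ω} (hA : MeasurableSet[N.sigmaΦ] A) :
    P (A ∩ N.goodEvent η ρ α N₀ γ t) = ∫⁻ ω in A, N.successProb η ρ α N₀ γ q r₀ ω ∂P := by
  obtain ⟨D, hD, rfl⟩ := hA
  have hB : MeasurableSet ((fun p : (ℕ → Plane) × ((ℕ × ℕ → ℂ) × (ℕ × ℕ → Fin 2)) =>
      pointMeasure p.1) ⁻¹' D ∩ canonical.goodEvent η ρ α N₀ γ t) :=
    ((measurable_pointMeasure.comp measurable_fst) hD).inter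
      (measurableSet_goodEvent_canonical η ρ α N₀ γ t)
  rw [← lintegral_indicator (hN.poisson.measurable hD)]
  refine (hN.measure_preimage_links hB).trans (lintegral_congr fun ω => ?_)
  by_cases hω : N.Φ ω ∈ D
  · rw [indicator_of_mem (mem_preimage.2 hω),
      ← hN.measure_goodEvent_freeze_eq hq₀ hq₁ hr₀ hη hρ hγ t]
    congr 1
    ext ω'
    exact and_iff_right hω
  · rw [indicator_of_notMem (by simpa using hω)]
    convert measure_empty (μ := P)
    ext ω'
    simp only [mem_ofPred_eq, mem_empty_iff_false, iff_false]
    exact fun h => hω h.1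

lemma integrable_successProb_pow (n : ℕ) :
    Integrable (fun ω => (q * (N.successProb η ρ α N₀ γ q r₀ ω).toReal) ^ n) P := by
  have hm : Measurable fun ω => (N.successProb η ρ α N₀ γ q r₀ ω).toReal :=
    hN.measurable_successProb.ennreal_toReal
  refine Integrable.of_bound (C := |q| ^ n) ((hm.const_mul q).pow_const n).aestronglyMeasurable
    (ae_of_all _ fun ω => ?_)
  have h1 : (N.successProb η ρ α N₀ γ q r₀ ω).toReal ≤ 1 :=
    ENNReal.toReal_mono (by simp) (expNeg_le_one _)
  rw [norm_pow, norm_mul, Real.norm_eq_abs, Real.norm_of_nonneg ENNReal.toReal_nonneg]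
  exact pow_le_pow_left₀ (by positivity) (mul_le_of_le_one_right (abs_nonneg q) h1) n

lemma condSuccess_ae_eq (hq₀ : 0 ≤ q) (hq₁ : q ≤ 1) (hr₀ : 0 < r₀) (hη : 0 < η)
    (hρ : 0 < ρ) (hγ : 0 < γ) (t : ℕ) :
    N.condSuccess P η ρ α N₀ γ t =ᵐ[P] fun ω => (N.successProb η ρ α N₀ γ q r₀ ω).toReal := by
  have hG := hN.measurableSet_goodEvent (η := η) (ρ := ρ) (α := α) (N₀ := N₀) (γ := γ) t
  have hmeas := N.measurable_successProb_sigmaΦ η ρ α N₀ γ q r₀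
  have hint : Integrable (fun ω => (N.successProb η ρ α N₀ γ q r₀ ω).toReal) P :=
    integrable_toReal_of_lintegral_ne_top hN.measurable_successProb.aemeasurable
      ((lintegral_mono fun ω => expNeg_le_one _).trans_lt (by simp)).ne
  refine (ae_eq_condExp_of_forall_setIntegral_eq hN.sigmaΦ_le
    ((integrable_const (1 : ℝ)).indicator hG) (fun _ _ _ => hint.integrableOn) (fun A hA _ => ?_)
    hmeas.ennreal_toReal.aestronglyMeasurable).symm
  rw [integral_toReal hN.measurable_successProb.aemeasurable
    (ae_of_all _ fun ω => (expNeg_ne_top _).lt_top),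
    ← hN.measure_inter_goodEvent hq₀ hq₁ hr₀ hη hρ hγ t hA, integral_indicator hG,
    Measure.restrict_restrict hG, inter_comm]
  simp [measureReal_def]

lemma moment_eq_integral (hq₀ : 0 ≤ q) (hq₁ : q ≤ 1) (hr₀ : 0 < r₀) (hη : 0 < η)
    (hρ : 0 < ρ) (hγ : 0 < γ) (t l : ℕ) :
    N.moment P η ρ α N₀ γ q t l =
      ∫ ω, (q * (N.successProb η ρ α N₀ γ q r₀ ω).toReal) ^ l ∂P := by
  refine integral_congr_ae ?_
  filter_upwards [hN.condSuccess_ae_eq hq₀ hq₁ hr₀ hη hρ hγ t] with ω hω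
  rw [hω]

/-- An `l`-th power of `expNeg` multiplies the exponent by `l`, so the moment is the Laplace
functional of `Φ` at `l * logLoss`. -/
lemma moment_eq_expNeg (hq₀ : 0 ≤ q) (hq₁ : q ≤ 1) (hr₀ : 0 < r₀) (hη : 0 < η)
    (hρ : 0 < ρ) (hN₀ : 0 ≤ N₀) (hγ : 0 < γ) (t l : ℕ) :
    N.moment P η ρ α N₀ γ q t l = q ^ l * Real.exp (-(γ * N₀ * l / (η * ρ * r₀ ^ (-α)))) *
      (expNeg (ENNReal.ofReal (2 * Real.pi * lam) * pgflIntegral q r₀ γ α l)).toReal := by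
  set b := γ * N₀ / (η * ρ * r₀ ^ (-α)) with hb
  have hb0 : 0 ≤ b := by positivity
  have hpow : ∀ ω, N.successProb η ρ α N₀ γ q r₀ ω ^ l =
      expNeg (l * ENNReal.ofReal b) * expNeg (∫⁻ y, l * logLoss q r₀ γ α ‖y‖ ∂(N.Φ ω)) :=
    fun ω => by
      rw [successProb, ← expNeg_nat_mul, mul_add, expNeg_add, lintegral_const_mul _ (by fun_prop)]
  have hm : Measurable fun ω => expNeg (∫⁻ y, l * logLoss q r₀ γ α ‖y‖ ∂(N.Φ ω)) :=
    measurable_expNeg.comp ((Measure.measurable_lintegral (by fun_prop)).comp hN.poisson.measurable)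
  have h1 : ∫ ω, (N.successProb η ρ α N₀ γ q r₀ ω ^ l).toReal ∂P =
      (∫⁻ ω, N.successProb η ρ α N₀ γ q r₀ ω ^ l ∂P).toReal :=
    integral_toReal (hN.measurable_successProb.pow_const l).aemeasurable
      (ae_of_all _ fun ω => (ENNReal.pow_lt_top (expNeg_ne_top _).lt_top))
  have h2 : (expNeg (l * ENNReal.ofReal b)).toReal =
      Real.exp (-(γ * N₀ * l / (η * ρ * r₀ ^ (-α)))) := by
    rw [expNeg_toReal (ENNReal.mul_ne_top (by simp) (by simp)), ENNReal.toReal_mul,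
      ENNReal.toReal_ofReal hb0, ENNReal.toReal_natCast, hb]
    congr 2
    ring
  rw [hN.moment_eq_integral hq₀ hq₁ hr₀ hη hρ hγ]
  simp only [mul_pow, integral_const_mul, ← ENNReal.toReal_pow]
  have hσ : SigmaFinite (ENNReal.ofReal lam • (volume : Measure Plane)) :=
    inferInstanceAs (SigmaFinite (lam.toNNReal • (volume : Measure Plane)))
  rw [h1, lintegral_congr hpow, lintegral_const_mul _ hm,
    hN.poisson.lintegral_expNeg (f := fun y => l * logLoss q r₀ γ α ‖y‖) (by fun_prop),
    lintegral_one_sub_expNeg_logLoss hq₀ hq₁ hr₀ hγ, ENNReal.toReal_mul, h2]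
  ring

lemma measureReal_runEvent_eq_integral (hq₀ : 0 ≤ q) (hq₁ : q ≤ 1) (hr₀ : 0 < r₀) (hη : 0 < η)
    (hρ : 0 < ρ) (hγ : 0 < γ) (b v T : ℕ) :
    P.real (runEvent (fun j => N.successEvent η ρ α N₀ γ (b + j)) v T) =
      ∫ ω, deMoivreSum (fun n => (q * (N.successProb η ρ α N₀ γ q r₀ ω).toReal) ^ n) T v ∂P := by
  have hB : MeasurableSet
      (runEvent (fun j => canonical.successEvent η ρ α N₀ γ (b + j)) v T) :=
    -- Only measurability is needed here, so a constant filtration serves.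
    measurableSet_runEvent (F := fun _ => inferInstance) (fun _ _ _ => le_rfl)
      (fun k => measurableSet_successEvent_canonical η ρ α N₀ γ (b + k)) v T
  have h1 := hN.measure_preimage_links hB
  have h2 : ∀ ω, (P {ω' | ((fun i => N.X i ω), N.links ω') ∈
      runEvent (fun j => canonical.successEvent η ρ α N₀ γ (b + j)) v T}).toReal =
      deMoivreSum (fun n => (q * (N.successProb η ρ α N₀ γ q r₀ ω).toReal) ^ n) T v := fun ω =>
    hN.measureReal_runEvent_freeze hq₀ (fun i => N.X i ω) (fun t => by
      rw [measureReal_def, hN.measure_goodEvent_freeze_eq hq₀ hq₁ hr₀ hη hρ hγ]) v T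
  have hX : Measurable fun ω => (fun i => N.X i ω : ℕ → Plane) :=
    measurable_pi_lambda _ hN.measurable_X
  have h3 : Measurable fun ω => P {ω' | ((fun i => N.X i ω), N.links ω') ∈
      runEvent (fun j => canonical.successEvent η ρ α N₀ γ (b + j)) v T} :=
    measurable_measure_prodMk_left
      (((hX.comp measurable_fst).prodMk (hN.measurable_links.comp measurable_snd)) hB)
  rw [← integral_congr_ae (ae_of_all _ h2), integral_toReal h3.aemeasurable
    (ae_of_all _ fun ω => measure_lt_top _ _), ← h1]
  -- By definition, the canonical network evaluated at the locations and links of `ω` is `N` at `ω`.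
  rfl

lemma integral_deMoivreSum (T v : ℕ) :
    ∫ ω, deMoivreSum (fun n => (q * (N.successProb η ρ α N₀ γ q r₀ ω).toReal) ^ n) T v ∂P =
      deMoivreSum
        (fun n => ∫ ω, (q * (N.successProb η ρ α N₀ γ q r₀ ω).toReal) ^ n ∂P) T v := by
  have hi := fun n => hN.integrable_successProb_pow (η := η) (ρ := ρ) (α := α) (N₀ := N₀) (γ := γ) n
  have hs : ∀ (s : Finset ℕ) (c : ℕ → ℝ) (e : ℕ → ℕ), Integrable (fun ω => ∑ j ∈ s,
      c j * (q * (N.successProb η ρ α N₀ γ q r₀ ω).toReal) ^ e j) P := fun s c e =>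
    integrable_finsetSum _ fun j _ => (hi (e j)).const_mul (c j)
  have hs' : ∀ (s : Finset ℕ) (c : ℕ → ℝ) (e : ℕ → ℕ), ∫ ω, ∑ j ∈ s,
      c j * (q * (N.successProb η ρ α N₀ γ q r₀ ω).toReal) ^ e j ∂P = ∑ j ∈ s,
      c j * ∫ ω, (q * (N.successProb η ρ α N₀ γ q r₀ ω).toReal) ^ e j ∂P := fun s c e => by
    rw [integral_finsetSum _ fun j _ => (hi (e j)).const_mul (c j)]
    simp only [integral_const_mul]
  simp only [deMoivreSum]
  rw [integral_finsetSum]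
  swap
  · exact fun l _ => ((hs _ _ _).add ((hs _ _ _).const_mul _)).const_mul _
  refine Finset.sum_congr rfl fun l _ => ?_
  rw [integral_const_mul, integral_add (hs _ _ _) ((hs _ _ _).const_mul _), integral_const_mul,
    hs', hs']

end IsClassicalAloha

end Network

end PoissonAloha

/-! ### Assembly -/

theorem mainTheorem4 {Ω : Type*} [MeasurableSpace Ω] (P : Measure Ω) [IsProbabilityMeasure P]
    (lam q r₀ η ρ α N₀ γ : ℝ) (hlam : 0 < lam) (hq₀ : 0 ≤ q) (hq₁ : q ≤ 1) (hr₀ : 0 < r₀)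
    (hη : 0 < η) (hρ : 0 < ρ) (hα : 0 < α) (hN₀ : 0 ≤ N₀) (hγ : 0 < γ)
    (N : Network Ω) (hN : N.IsClassicalAloha P lam q r₀)
    {n : ℕ} (A : Matrix (Fin n) (Fin n) ℝ) (T k t : ℕ) :
    -- the conditional success probability `P_cls`
    N.condSuccess P η ρ α N₀ γ t =ᵐ[P] (fun ω =>
      Real.exp (-(γ * N₀ / (η * ρ * r₀ ^ (-α)))) * ∏' i : ℕ, factor q r₀ γ α (N.r (i + 1) ω)) ∧
    -- the probability of block controllability as a de Moivre sum in the moments of `q P_cls`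
    P.real {ω | BlockControllable A T k (fun τ => N.S η ρ α N₀ γ τ ω)} =
      deMoivreSum (N.moment P η ρ α N₀ γ q t) T (minpoly ℝ A).natDegree ∧
    -- the moments through the generating functional of the Poisson process
    (∀ l : ℕ, N.moment P η ρ α N₀ γ q t l =
      q ^ l * Real.exp (-(γ * N₀ * l / (η * ρ * r₀ ^ (-α)))) *
        (EReal.exp (-((ENNReal.ofReal (2 * Real.pi * lam) * pgflIntegral q r₀ γ α l : ℝ≥0∞) :
          EReal))).toReal) ∧
    -- for `α > 2` all integrals converge and may be expanded binomially
    (2 < α →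
      (∀ l : ℕ, pgflIntegral q r₀ γ α l ≠ ∞) ∧
      (∀ j : ℕ, 1 ≤ j → IntegrableOn (expansionIntegrand q r₀ γ α j) (Ioi 0)) ∧
      ∀ l : ℕ, N.moment P η ρ α N₀ γ q t l =
        q ^ l * Real.exp (-(γ * N₀ * l / (η * ρ * r₀ ^ (-α)))) *
          Real.exp (2 * Real.pi * lam * ∑ j ∈ Finset.Icc 1 l, (l.choose j : ℝ) *
            ∫ z in Ioi (0 : ℝ), expansionIntegrand q r₀ γ α j z)) := by
  have hmoment := hN.moment_eq_expNeg (α := α) hq₀ hq₁ hr₀ hη hρ hN₀ hγ t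
  refine ⟨?_, ?_, hmoment, fun hα2 => ⟨fun l => ?_, fun j hj =>
    integrableOn_expansionIntegrand hq₀ hq₁ hr₀ hγ hα2 hj, fun l => ?_⟩⟩
  · filter_upwards [hN.condSuccess_ae_eq hq₀ hq₁ hr₀ hη hρ hγ t] with ω hω
    have hb : 0 ≤ γ * N₀ / (η * ρ * r₀ ^ (-α)) := by positivity
    rw [hω, N.successProb_eq, expNeg_add, ENNReal.toReal_mul, expNeg_ofReal hb,
      ENNReal.toReal_ofReal (Real.exp_pos _).le]
    congr 1
    exact (tprod_factor hq₀ hq₁ hr₀ hγ fun i => norm_nonneg _).symm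
  · rw [N.setOf_blockControllable, hN.measureReal_runEvent_eq_integral hq₀ hq₁ hr₀ hη hρ hγ,
      hN.integral_deMoivreSum]
    congr 1
    -- The slot `t` in the moments is arbitrary: `successProb` does not depend on it.
    exact funext fun l => (hN.moment_eq_integral hq₀ hq₁ hr₀ hη hρ hγ t l).symm
  · rw [(pgflIntegral_eq_ofReal hq₀ hq₁ hr₀ hγ hα2 l).1]
    exact ENNReal.ofReal_ne_top
  · obtain ⟨h1, h2⟩ := pgflIntegral_eq_ofReal hq₀ hq₁ hr₀ hγ hα2 l
    rw [hmoment, h1, ← ENNReal.ofReal_mul (by positivity), expNeg_ofReal (by positivity),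
      ENNReal.toReal_ofReal (Real.exp_pos _).le, mul_neg, neg_neg]
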